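/- Let $d\ge 1$ be an integer and $0<s<1$, and let $(-\Delta)^s$ be the fractional Laplacian, i.e. the Fourier multiplier $(-\Delta)^s u=\mathcal F^{-1}(|\xi|^{2s}\mathcal F u)$ (in the convention $\mathcal F u(\xi)=\int e^{-ix\cdot\xi}u(x)\,dx$). Let $\Omega$ and $D$ be nonempty bounded smooth domains in $\mathbb R^d$ with $\overline D\cap\overline\Omega=\emptyset$, put $\Omega_e:=\mathbb R^d\setminus\overline\Omega$, and let $\phi\in C_c^\infty(\Omega_e)$ be real-valued. For $f\in L^\infty(\Omega)$ with $f\ge 0$, let $u_f\in H^s(\mathbb R^d)$ be the unique real-valued (weak) solution of $$((-\Delta)^s+f)u=0\ \text{ in }\Omega,\qquad u|_{\Omega_e}=\phi,$$ that is, $u_f-\phi$ lies in the closure $\widetilde H^s(\Omega)$ of $C_c^\infty(\Omega)$ in $H^s(\mathbb R^d)$ and the equation holds in the sense of distributions in $\Omega$; let $G(f):=(-\Delta)^s u_f|_D$ (restriction of a distribution to $D$). Then there is a constant $C>0$, depending only on $d$, $s$, the Lebesgue measure $|\Omega|$, the distance $\operatorname{dist}(\Omega,D)=\inf\{|x-y|:x\in\Omega,\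 y\in D\}$ and $\phi$ (in particular independent of $f$), such that for every such $f$ the distribution $G(f)$ is a function in $L^\infty(D)$ and $$\|G(f)\|_{L^\infty(D)}\le C.$$ -/

import Mathlib

open MeasureTheory
open scoped ContDiff FourierTransform ENNReal SchwartzMap

noncomputable section

namespace FracSchrodinger

/-- A nonempty bounded smooth domain of `ℝ^d`: a nonempty, connected, bounded open set which near
each of its boundary points is the sublevel set `{ρ < 0}` of a smooth function `ρ` with nonvanishing
differential at that point. -/
structure IsBoundedSmoothDomain {d : ℕ} (Ω : Set (EuclideanSpace ℝ (Fin d))) : Prop where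
  isOpen : IsOpen Ω
  isConnected : IsConnected Ω
  isBounded : Bornology.IsBounded Ω
  smooth_boundary : ∀ x ∈ frontier Ω, ∃ ρ : EuclideanSpace ℝ (Fin d) → ℝ,
    ContDiff ℝ ∞ ρ ∧ fderiv ℝ ρ x ≠ 0 ∧ ∀ᶠ y in nhds x, (y ∈ Ω ↔ ρ y < 0)

/-- The distance `dist(A, B) = inf {|x - y| : x ∈ A, y ∈ B}` between two sets. -/
def setDist {d : ℕ} (A B : Set (EuclideanSpace ℝ (Fin d))) : ℝ :=
  sInf (Set.image2 dist A B)

/-- The class `C_c^∞(U)`: smooth real functions whose support is a compact subset of `U`. -/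
def IsTestFunction {d : ℕ} (U : Set (EuclideanSpace ℝ (Fin d)))
    (ψ : EuclideanSpace ℝ (Fin d) → ℝ) : Prop :=
  ContDiff ℝ ∞ ψ ∧ HasCompactSupport ψ ∧ tsupport ψ ⊆ U

/-- A real-valued `L²` function on `ℝ^d`, seen as a complex-valued one. -/
def complexify {d : ℕ} (u : Lp ℝ 2 (volume : Measure (EuclideanSpace ℝ (Fin d)))) :
    Lp ℂ 2 (volume : Measure (EuclideanSpace ℝ (Fin d))) :=
  Complex.ofRealCLM.compLp u

/-- The square of the norm of `H^s(ℝ^d)`, namely `∫ (1 + |ξ|²)^s |û(ξ)|² dξ`, with the Fourier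
transform `û(ξ) = ∫ exp(-2πi x·ξ) u(x) dx` (the choice of the frequency unit only changes
the norm to an equivalent one). -/
def sobolevNormSq {d : ℕ} (s : ℝ)
    (u : Lp ℝ 2 (volume : Measure (EuclideanSpace ℝ (Fin d)))) : ℝ≥0∞ :=
  ∫⁻ ξ, ENNReal.ofReal ((1 + ‖ξ‖ ^ 2) ^ s) * ‖𝓕 (complexify u) ξ‖ₑ ^ 2

/-- Membership in `H^s(ℝ^d)`, the `L²`-based Sobolev space defined through the Fourier
transform. -/
def MemH {d : ℕ} (s : ℝ) (u : Lp ℝ 2 (volume : Measure (EuclideanSpace ℝ (Fin d)))) : Prop :=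
  TemperedDistribution.MemSobolev s 2 (complexify u : 𝓢'(EuclideanSpace ℝ (Fin d), ℂ))

/-- Membership in the space `H̃^s(Ω)`, the closure of `C_c^∞(Ω)` in `H^s(ℝ^d)`. -/
def MemHTilde {d : ℕ} (s : ℝ) (Ω : Set (EuclideanSpace ℝ (Fin d)))
    (w : Lp ℝ 2 (volume : Measure (EuclideanSpace ℝ (Fin d)))) : Prop :=
  MemH s w ∧ ∀ ε : ℝ≥0∞, 0 < ε →
    ∃ (ψ : EuclideanSpace ℝ (Fin d) → ℝ)
      (v : Lp ℝ 2 (volume : Measure (EuclideanSpace ℝ (Fin d)))),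
      IsTestFunction Ω ψ ∧ v =ᵐ[volume] ψ ∧ sobolevNormSq s (w - v) < ε

/-- The value `⟨(-Δ)^s u, ψ⟩` of the distribution `(-Δ)^s u = 𝓕⁻¹(|2πξ|^{2s} 𝓕u)` at a test function
`ψ ∈ C_c^∞(ℝ^d)`. In the convention of Mathlib for the Fourier transform the symbol of `(-Δ)^s` is
`|2πξ|^{2s}`. The integrand is integrable for every `u ∈ L²` and `s ≥ 0`. -/
def fracLaplacian {d : ℕ} (s : ℝ) (u : Lp ℝ 2 (volume : Measure (EuclideanSpace ℝ (Fin d))))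
    (ψ : EuclideanSpace ℝ (Fin d) → ℝ) : ℂ :=
  ∫ ξ, (((2 * Real.pi * ‖ξ‖) ^ (2 * s) : ℝ) : ℂ) * 𝓕 (complexify u) ξ *
    𝓕⁻ (fun x ↦ (ψ x : ℂ)) ξ

/-- `u ∈ H^s(ℝ^d)` is a (weak) solution of the exterior value problem
`((-Δ)^s + f) u = 0` in `Ω`, `u = φ` in `ℝ^d \ closure Ω`. The equation holds in the sense of
distributions on `Ω`, and the exterior condition means, as usual, `u - φ ∈ H̃^s(Ω)`. -/
structure IsSolution {d : ℕ} (s : ℝ) (Ω : Set (EuclideanSpace ℝ (Fin d)))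
    (f φ : EuclideanSpace ℝ (Fin d) → ℝ)
    (u : Lp ℝ 2 (volume : Measure (EuclideanSpace ℝ (Fin d)))) : Prop where
  memH : MemH s u
  exterior : ∃ φ' : Lp ℝ 2 (volume : Measure (EuclideanSpace ℝ (Fin d))),
    φ' =ᵐ[volume] φ ∧ MemHTilde s Ω (u - φ')
  equation : ∀ ψ : EuclideanSpace ℝ (Fin d) → ℝ, IsTestFunction Ω ψ →
    fracLaplacian s u ψ + ((∫ x in Ω, f x * u x * ψ x : ℝ) : ℂ) = 0

/-- The restriction of the distribution `(-Δ)^s u` to the open set `D` is the function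
`g ∈ L^∞(D)`. -/
def FracLaplacianEqOn {d : ℕ} (s : ℝ)
    (u : Lp ℝ 2 (volume : Measure (EuclideanSpace ℝ (Fin d))))
    (D : Set (EuclideanSpace ℝ (Fin d))) (g : EuclideanSpace ℝ (Fin d) → ℝ) : Prop :=
  MemLp g ∞ (volume.restrict D) ∧
    ∀ ψ : EuclideanSpace ℝ (Fin d) → ℝ, IsTestFunction D ψ →
      fracLaplacian s u ψ = ((∫ x in D, g x * ψ x : ℝ) : ℂ)

end FracSchrodinger

end

/-!
Write `u = φ + w` with `w ∈ H̃^s(Ω)`. Since `w` vanishes near `D`, subordination of `(-Δ)^s` to the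
heat semigroup gives, for `x ∈ D` and with `c` the normalizing constant,
`(-Δ)^s u (x) = (-Δ)^s φ (x) - ∫_Ω c |x - y|^(-d-2s) w(y) dy`.
The first term is at most `‖|ξ|^(2s) φ̂‖_{L¹}`, and by Cauchy-Schwarz the second is at most
`c dist(Ω, D)^(-d-2s) |Ω|^(1/2) ‖w‖_{L²}`. It remains to bound `‖w‖_{L²}` independently of `f`. Test
the equation with `w`: as `φ = 0` on `Ω`, the potential contributes `∫_Ω f w² ≥ 0`, so
`⟨(-Δ)^s w, w⟩ ≤ ‖(-Δ)^s φ‖_{L²} ‖w‖_{L²}`. The Poincaré inequality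
`‖w‖²_{L²} ≤ P ⟨(-Δ)^s w, w⟩` holds with `P` depending only on `d`, `s` and `|Ω|`: low frequencies
are controlled by `|ŵ| ≤ |Ω|^(1/2) ‖w‖_{L²}` and high frequencies by the symbol.
-/

noncomputable section

namespace FracSchrodinger

open Set Filter Topology Real
open scoped ComplexConjugate

section Subordination

lemma one_sub_exp_neg_mul_nonneg {a t : ℝ} (ha : 0 ≤ a) (ht : 0 ≤ t) :
    0 ≤ 1 - exp (-(t * a)) := by
  have : 0 ≤ t * a := mul_nonneg ht ha
  linarith [exp_le_one_iff.2 (neg_nonpos.2 this)]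

lemma one_sub_exp_neg_le_self (x : ℝ) : 1 - exp (-x) ≤ x := by
  linarith [add_one_le_exp (-x)]

lemma integrableOn_one_sub_exp_neg_mul_rpow {s : ℝ} (hs0 : 0 < s) (hs1 : s < 1) {a : ℝ}
    (ha : 0 ≤ a) :
    IntegrableOn (fun t : ℝ ↦ (1 - exp (-(t * a))) * t ^ (-1 - s)) (Ioi 0) := by
  have hmeas (A : Set ℝ) : AEStronglyMeasurable
      (fun t : ℝ ↦ (1 - exp (-(t * a))) * t ^ (-1 - s)) (volume.restrict A) :=
    Measurable.aestronglyMeasurable (by fun_prop)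
  have hnorm {t : ℝ} (ht : 0 < t) : ‖(1 - exp (-(t * a))) * t ^ (-1 - s)‖ =
      (1 - exp (-(t * a))) * t ^ (-1 - s) :=
    norm_of_nonneg (mul_nonneg (one_sub_exp_neg_mul_nonneg ha ht.le) (rpow_nonneg ht.le _))
  rw [← Ioc_union_Ioi_eq_Ioi zero_le_one]
  refine IntegrableOn.union ?near_zero ?near_infinity
  case near_zero =>
    have hdom : IntegrableOn (fun t : ℝ ↦ a * t ^ (-s)) (Ioc 0 1) :=
      ((intervalIntegrable_iff_integrableOn_Ioc_of_le zero_le_one).1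
        (intervalIntegral.intervalIntegrable_rpow' (by linarith))).const_mul a
    refine hdom.mono' (hmeas _) ?_
    filter_upwards [ae_restrict_mem measurableSet_Ioc] with t ht
    calc ‖(1 - exp (-(t * a))) * t ^ (-1 - s)‖
        ≤ t * a * t ^ (-1 - s) := by
          rw [hnorm ht.1]
          exact mul_le_mul_of_nonneg_right (one_sub_exp_neg_le_self _) (rpow_nonneg ht.1.le _)
      _ = a * t ^ (-s) := by
          rw [show -s = 1 + (-1 - s) by ring, rpow_add ht.1, rpow_one]; ring
  case near_infinity =>
    refine (integrableOn_Ioi_rpow_of_lt (show -1 - s < -1 by linarith) zero_lt_one).mono'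
      (hmeas _) ?_
    filter_upwards [ae_restrict_mem measurableSet_Ioi] with t (ht : 1 < t)
    rw [hnorm (by positivity)]
    exact mul_le_of_le_one_left (by positivity) (by linarith [exp_pos (-(t * a))])

lemma tendsto_one_sub_exp_neg_mul_rpow_nhdsGT_zero {s : ℝ} (hs1 : s < 1) {a : ℝ} (ha : 0 ≤ a) :
    Tendsto (fun t : ℝ ↦ (1 - exp (-(t * a))) * t ^ (-s)) (𝓝[>] 0) (𝓝 0) := by
  have hlim : Tendsto (fun t : ℝ ↦ a * t ^ (1 - s)) (𝓝[>] 0) (𝓝 0) := by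
    have h := ((continuous_rpow_const (show 0 ≤ 1 - s by linarith)).const_mul a).tendsto 0
    rw [zero_rpow (by linarith), mul_zero] at h
    exact h.mono_left nhdsWithin_le_nhds
  refine squeeze_zero' ?_ ?_ hlim <;> filter_upwards [self_mem_nhdsWithin] with t (ht : 0 < t)
  · exact mul_nonneg (one_sub_exp_neg_mul_nonneg ha ht.le) (rpow_nonneg ht.le _)
  · calc (1 - exp (-(t * a))) * t ^ (-s)
        ≤ t * a * t ^ (-s) :=
          mul_le_mul_of_nonneg_right (one_sub_exp_neg_le_self _) (rpow_nonneg ht.le _)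
      _ = a * t ^ (1 - s) := by rw [sub_eq_add_neg, rpow_add ht, rpow_one]; ring

lemma tendsto_one_sub_exp_neg_mul_rpow_atTop {s : ℝ} (hs0 : 0 < s) {a : ℝ} (ha : 0 ≤ a) :
    Tendsto (fun t : ℝ ↦ (1 - exp (-(t * a))) * t ^ (-s)) atTop (𝓝 0) := by
  refine squeeze_zero' ?_ ?_ (tendsto_rpow_neg_atTop hs0) <;>
    filter_upwards [eventually_ge_atTop 0] with t ht
  · exact mul_nonneg (one_sub_exp_neg_mul_nonneg ha ht) (rpow_nonneg ht _)
  · exact mul_le_of_le_one_left (rpow_nonneg ht _) (by linarith [exp_pos (-(t * a))])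

lemma integral_mul_exp_neg_mul_rpow_neg {s : ℝ} (hs1 : s < 1) {a : ℝ} (ha : 0 < a) :
    ∫ t in Ioi (0 : ℝ), a * exp (-(t * a)) * t ^ (-s) = Gamma (1 - s) * a ^ s := by
  have h := integral_rpow_mul_exp_neg_mul_Ioi (show 0 < 1 - s by linarith) ha
  simp only [show 1 - s - 1 = -s by ring, mul_comm a, mul_comm (_ ^ (-s))] at h
  simp only [mul_assoc]
  rw [integral_const_mul, h, one_div, inv_rpow ha.le, rpow_sub ha, rpow_one]
  field_simp

lemma integral_one_sub_exp_neg_mul_rpow {s : ℝ} (hs0 : 0 < s) (hs1 : s < 1) {a : ℝ}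
    (ha : 0 ≤ a) :
    ∫ t in Ioi (0 : ℝ), (1 - exp (-(t * a))) * t ^ (-1 - s) = Gamma (1 - s) / s * a ^ s := by
  rcases ha.eq_or_lt with rfl | ha
  · simp [zero_rpow hs0.ne']
  have hexp := integral_mul_exp_neg_mul_rpow_neg hs1 ha
  have hexp_int : IntegrableOn (fun t : ℝ ↦ a * exp (-(t * a)) * t ^ (-s)) (Ioi 0) := by
    refine .of_integral_ne_zero ?_
    rw [hexp]
    have := Gamma_pos_of_pos (show 0 < 1 - s by linarith)
    positivity
  have hparts := integral_Ioi_mul_deriv_eq_deriv_mul (a := 0)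
    (u := fun t ↦ 1 - exp (-(t * a))) (u' := fun t ↦ a * exp (-(t * a)))
    (v := fun t ↦ t ^ (-s) * (-s)⁻¹) (v' := fun t ↦ t ^ (-1 - s)) (a' := 0) (b' := 0)
    (fun t _ ↦ ?deriv_exp) (fun t ht ↦ ?deriv_rpow)
    (integrableOn_one_sub_exp_neg_mul_rpow hs0 hs1 ha.le) ?integrable ?lim_zero ?lim_top
  case deriv_exp =>
    exact (((hasDerivAt_mul_const a).neg.exp).const_sub 1).congr_deriv (by simp; ring)
  case deriv_rpow =>
    refine ((hasDerivAt_rpow_const (.inl (ne_of_gt ht))).mul_const _).congr_deriv ?_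
    rw [show -1 - s = -s - 1 by ring]
    field_simp
  case integrable =>
    exact .congr_fun (hexp_int.mul_const (-s)⁻¹) (fun t _ ↦ mul_assoc _ _ _) measurableSet_Ioi
  case lim_zero =>
    simpa only [Pi.mul_def, mul_assoc, zero_mul] using
      (tendsto_one_sub_exp_neg_mul_rpow_nhdsGT_zero hs1 ha.le).mul_const (-s)⁻¹
  case lim_top =>
    simpa only [Pi.mul_def, mul_assoc, zero_mul] using
      (tendsto_one_sub_exp_neg_mul_rpow_atTop hs0 ha.le).mul_const (-s)⁻¹
  calc ∫ t in Ioi (0 : ℝ), (1 - exp (-(t * a))) * t ^ (-1 - s)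
      = s⁻¹ * ∫ t in Ioi (0 : ℝ), a * exp (-(t * a)) * t ^ (-s) := by
        rw [hparts, sub_zero, zero_sub, ← integral_neg, ← integral_const_mul]
        congr 1 with t
        field_simp
    _ = Gamma (1 - s) / s * a ^ s := by rw [hexp]; ring

lemma integral_rpow_mul_exp_neg_div {p c : ℝ} (hp : 0 < p) (hc : 0 < c) :
    ∫ t in Ioi (0 : ℝ), t ^ (-1 - p) * exp (-(c / t)) = Gamma p / c ^ p := by
  have h := integral_rpow_mul_exp_neg_mul_Ioi hp hc
  rw [← integral_comp_rpow_Ioi _ (show (-1 : ℝ) ≠ 0 by norm_num)] at h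
  rw [div_eq_inv_mul, ← inv_rpow hc.le, ← one_div, ← h]
  refine setIntegral_congr_fun measurableSet_Ioi fun t (ht : 0 < t) ↦ ?_
  simp only [smul_eq_mul, abs_neg, abs_one, one_mul, rpow_neg_one]
  rw [inv_rpow ht.le, ← rpow_neg ht.le, ← mul_assoc, ← rpow_add ht, div_eq_mul_inv]
  congr 2
  ring

end Subordination

section Symbols

variable {E : Type*} [NormedAddCommGroup E]

/-- The symbol `exp (-t |2πξ|²)` of the heat semigroup `exp (tΔ)`, in Mathlib's convention
`𝓕 u ξ = ∫ exp (-2πi x·ξ) u x` for the Fourier transform. -/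
def heatSymbol (t : ℝ) (ξ : E) : ℝ := exp (-(t * (2 * π * ‖ξ‖) ^ 2))

/-- The symbol `|2πξ|^{2s}` of `(-Δ)^s`, in the same convention. -/
def fracSymbol (s : ℝ) (ξ : E) : ℝ := (2 * π * ‖ξ‖) ^ (2 * s)

lemma continuous_heatSymbol (t : ℝ) : Continuous (heatSymbol t : E → ℝ) := by
  unfold heatSymbol
  fun_prop

lemma heatSymbol_le_one {t : ℝ} (ht : 0 ≤ t) (ξ : E) : heatSymbol t ξ ≤ 1 := by
  have : 0 ≤ t * (2 * π * ‖ξ‖) ^ 2 := by positivity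
  exact exp_le_one_iff.2 (by linarith)

lemma ofReal_heatSymbol (t : ℝ) (ξ : E) :
    (heatSymbol t ξ : ℂ) = Complex.exp (-((4 * π ^ 2 * t : ℝ) : ℂ) * ‖ξ‖ ^ 2) := by
  rw [heatSymbol, Complex.ofReal_exp]
  push_cast
  ring_nf

lemma fracSymbol_nonneg (s : ℝ) (ξ : E) : 0 ≤ fracSymbol s ξ := by
  unfold fracSymbol
  positivity

lemma continuous_fracSymbol {s : ℝ} (hs0 : 0 ≤ s) : Continuous (fracSymbol s : E → ℝ) :=
  Continuous.rpow_const (by fun_prop) fun _ ↦ .inr (by positivity)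

lemma integrableOn_one_sub_heatSymbol_mul_rpow {s : ℝ} (hs0 : 0 < s) (hs1 : s < 1) (ξ : E) :
    IntegrableOn (fun t : ℝ ↦ (1 - heatSymbol t ξ) * t ^ (-1 - s)) (Ioi 0) :=
  integrableOn_one_sub_exp_neg_mul_rpow hs0 hs1 (sq_nonneg _)

lemma fracSymbol_eq_integral {s : ℝ} (hs0 : 0 < s) (hs1 : s < 1) (ξ : E) :
    fracSymbol s ξ =
      s / Gamma (1 - s) * ∫ t in Ioi (0 : ℝ), (1 - heatSymbol t ξ) * t ^ (-1 - s) := by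
  have hΓ : Gamma (1 - s) ≠ 0 := (Gamma_pos_of_pos (by linarith)).ne'
  simp only [heatSymbol]
  rw [integral_one_sub_exp_neg_mul_rpow hs0 hs1 (sq_nonneg _), fracSymbol,
    rpow_mul (by positivity), rpow_two]
  field_simp

end Symbols

section Kernels

/-- The heat kernel of an `n`-dimensional Euclidean space at time `t`, i.e. the convolution kernel
of `exp (tΔ)`, as a function of the distance `r`. -/
def heatKernel (n : ℕ) (t r : ℝ) : ℝ :=
  (4 * π * t) ^ (-(n / 2) : ℝ) * exp (-(r ^ 2 / 4 / t))

lemma measurable_heatKernel (n : ℕ) : Measurable fun p : ℝ × ℝ ↦ heatKernel n p.1 p.2 := by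
  unfold heatKernel
  fun_prop

lemma heatKernel_nonneg (n : ℕ) {t : ℝ} (ht : 0 ≤ t) (r : ℝ) : 0 ≤ heatKernel n t r := by
  unfold heatKernel
  positivity

/-- The normalizing constant `c_{n,s}` of the singular integral representation
`(-Δ)^s u(x) = c_{n,s} ∫ (u(x) - u(y)) / |x - y|^{n+2s} dy` on an `n`-dimensional space. -/
def fracLaplacianConst (n : ℕ) (s : ℝ) : ℝ :=
  s * 4 ^ s * Gamma (s + n / 2) / (π ^ (n / 2 : ℝ) * Gamma (1 - s))

/-- The jump kernel `c_{n,s} / r^{n+2s}` of `(-Δ)^s` on an `n`-dimensional Euclidean space, as a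
function of the distance `r`. Its value at `r = 0` is meaningless. -/
def jumpKernel (n : ℕ) (s r : ℝ) : ℝ := fracLaplacianConst n s / r ^ (n + 2 * s)

lemma fracLaplacianConst_pos (n : ℕ) {s : ℝ} (hs0 : 0 < s) (hs1 : s < 1) :
    0 < fracLaplacianConst n s := by
  have : 0 < Gamma (1 - s) := Gamma_pos_of_pos (by linarith)
  have : 0 < Gamma (s + n / 2) := Gamma_pos_of_pos (by positivity)
  unfold fracLaplacianConst
  positivity

lemma jumpKernel_nonneg (n : ℕ) {s : ℝ} (hs0 : 0 < s) (hs1 : s < 1) {r : ℝ} (hr : 0 ≤ r) :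
    0 ≤ jumpKernel n s r :=
  div_nonneg (fracLaplacianConst_pos n hs0 hs1).le (by positivity)

lemma jumpKernel_le_jumpKernel (n : ℕ) {s : ℝ} (hs0 : 0 < s) (hs1 : s < 1) {δ r : ℝ} (hδ : 0 < δ)
    (hr : δ ≤ r) : jumpKernel n s r ≤ jumpKernel n s δ := by
  have := (fracLaplacianConst_pos n hs0 hs1).le
  unfold jumpKernel
  gcongr

lemma measurable_jumpKernel (n : ℕ) (s : ℝ) : Measurable (jumpKernel n s) := by
  unfold jumpKernel
  fun_prop

lemma integral_rpow_mul_heatKernel (n : ℕ) {s : ℝ} (hs0 : 0 < s) {r : ℝ} (hr : 0 < r) :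
    ∫ t in Ioi (0 : ℝ), t ^ (-1 - s) * heatKernel n t r =
      4 ^ s * Gamma (s + n / 2) / (π ^ (n / 2 : ℝ) * r ^ (n + 2 * s)) := by
  have hpow : (r ^ 2 / 4) ^ (s + n / 2) = r ^ (n + 2 * s) / (4 ^ s * 4 ^ (n / 2 : ℝ)) := by
    rw [div_rpow (by positivity) (by norm_num), rpow_add (x := 4) (by norm_num), ← rpow_two,
      ← rpow_mul hr.le]
    ring_nf
  calc ∫ t in Ioi (0 : ℝ), t ^ (-1 - s) * heatKernel n t r
      = ∫ t in Ioi (0 : ℝ), (4 * π) ^ (-(n / 2) : ℝ) *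
          (t ^ (-1 - (s + n / 2)) * exp (-(r ^ 2 / 4 / t))) := by
        refine setIntegral_congr_fun measurableSet_Ioi fun t (ht : 0 < t) ↦ ?_
        simp only [heatKernel]
        rw [mul_rpow (by positivity) ht.le, show -1 - (s + n / 2) = -1 - s + -(n / 2 : ℝ) by ring,
          rpow_add ht]
        ring
    _ = 4 ^ s * Gamma (s + n / 2) / (π ^ (n / 2 : ℝ) * r ^ (n + 2 * s)) := by
        rw [integral_const_mul, integral_rpow_mul_exp_neg_div (by positivity) (by positivity),
          hpow, rpow_neg (by positivity), mul_rpow (by norm_num) pi_nonneg]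
        field_simp

lemma integrableOn_rpow_mul_heatKernel (n : ℕ) {s : ℝ} (hs0 : 0 < s) {r : ℝ} (hr : 0 < r) :
    IntegrableOn (fun t : ℝ ↦ t ^ (-1 - s) * heatKernel n t r) (Ioi 0) := by
  refine .of_integral_ne_zero ?_
  have : 0 < Gamma (s + n / 2) := Gamma_pos_of_pos (by positivity)
  rw [integral_rpow_mul_heatKernel n hs0 hr]
  positivity

lemma jumpKernel_eq_integral (n : ℕ) {s : ℝ} (hs0 : 0 < s) {r : ℝ} (hr : 0 < r) :
    jumpKernel n s r =
      s / Gamma (1 - s) * ∫ t in Ioi (0 : ℝ), t ^ (-1 - s) * heatKernel n t r := by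
  rw [integral_rpow_mul_heatKernel n hs0 hr, jumpKernel, fracLaplacianConst]
  field_simp

end Kernels

/-- The sets `A` and `B` are at distance at least `δ` from each other. Used for the sets `Ω` and
`D` of the theorem, and for the supports of functions. -/
def IsSeparatedBy {X : Type*} [PseudoMetricSpace X] (δ : ℝ) (A B : Set X) : Prop :=
  ∀ y ∈ A, ∀ x ∈ B, δ ≤ dist y x

lemma IsSeparatedBy.mono {X : Type*} [PseudoMetricSpace X] {δ : ℝ} {A A' B B' : Set X}
    (h : IsSeparatedBy δ A B) (hA : A' ⊆ A) (hB : B' ⊆ B) : IsSeparatedBy δ A' B' :=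
  fun y hy x hx ↦ h y (hA hy) x (hB hx)

lemma IsSeparatedBy.symm {X : Type*} [PseudoMetricSpace X] {δ : ℝ} {A B : Set X}
    (h : IsSeparatedBy δ A B) : IsSeparatedBy δ B A :=
  fun x hx y hy ↦ dist_comm y x ▸ h y hy x hx

lemma IsSeparatedBy.le_norm_sub {E : Type*} [SeminormedAddCommGroup E] {δ : ℝ} {v ψ : E → ℂ}
    (hsep : IsSeparatedBy δ (Function.support v) (Function.support ψ)) {p : E × E}
    (hp : v p.1 * ψ p.2 ≠ 0) : δ ≤ ‖p.2 - p.1‖ := by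
  rw [norm_sub_rev, ← dist_eq_norm]
  exact hsep _ (left_ne_zero_of_mul hp) _ (right_ne_zero_of_mul hp)

lemma IsSeparatedBy.norm_jumpKernel_mul_le {E : Type*} [SeminormedAddCommGroup E] (n : ℕ)
    {s : ℝ} (hs0 : 0 < s) (hs1 : s < 1) {δ : ℝ} (hδ : 0 < δ) {v ψ : E → ℂ}
    (hsep : IsSeparatedBy δ (Function.support v) (Function.support ψ)) (p : E × E) :
    ‖(jumpKernel n s ‖p.2 - p.1‖ : ℂ) * (v p.1 * ψ p.2)‖ ≤
      jumpKernel n s δ * ‖v p.1 * ψ p.2‖ := by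
  by_cases hp : v p.1 * ψ p.2 = 0
  · simp [hp]
  · rw [norm_mul, Complex.norm_real, norm_of_nonneg (jumpKernel_nonneg n hs0 hs1 (norm_nonneg _))]
    exact mul_le_mul_of_nonneg_right
      (jumpKernel_le_jumpKernel n hs0 hs1 hδ (hsep.le_norm_sub hp)) (norm_nonneg _)

lemma integral_integral_mul_swap_of_nonneg {S T : Type*} [MeasurableSpace S] [MeasurableSpace T]
    {μ : Measure S} {ν : Measure T} [SFinite μ] [SFinite ν] {A : T → S → ℝ} {h : S → ℂ}
    (hA : Measurable A.uncurry) (hA0 : ∀ z, ∀ᵐ t ∂ν, 0 ≤ A t z)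
    (hA_int : ∀ z, h z ≠ 0 → Integrable (A · z) ν) (hh : AEStronglyMeasurable h μ)
    (hint : Integrable (fun z ↦ ((∫ t, A t z ∂ν : ℝ) : ℂ) * h z) μ) :
    ∫ z, ((∫ t, A t z ∂ν : ℝ) : ℂ) * h z ∂μ = ∫ t, ∫ z, (A t z : ℂ) * h z ∂μ ∂ν := by
  have hprod : Integrable (fun q : S × T ↦ (A q.2 q.1 : ℂ) * h q.1) (μ.prod ν) := by
    have hA' : Measurable fun q : S × T ↦ A q.2 q.1 := hA.comp measurable_swap
    refine (integrable_prod_iff ?_).2 ⟨ae_of_all _ fun z ↦ ?_, ?_⟩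
    · exact (Complex.measurable_ofReal.comp hA').aestronglyMeasurable.mul hh.comp_fst
    · rcases eq_or_ne (h z) 0 with hz | hz
      · simp [hz]
      · exact (hA_int z hz).ofReal.mul_const (h z)
    · refine hint.norm.congr (ae_of_all _ fun z ↦ ?_)
      have hnorm : ∫ t, ‖A t z‖ ∂ν = ∫ t, A t z ∂ν :=
        integral_congr_ae ((hA0 z).mono fun t ht ↦ norm_of_nonneg ht)
      simp only [norm_mul, Complex.norm_real, integral_mul_const, hnorm]
      rw [norm_of_nonneg (integral_nonneg_of_ae (hA0 z))]
  rw [← integral_integral_swap hprod]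
  simp only [integral_mul_const, integral_complex_ofReal]

section KernelFormula

variable {E : Type*} [NormedAddCommGroup E] [InnerProductSpace ℝ E] [FiniteDimensional ℝ E]
  [MeasurableSpace E] [BorelSpace E]

lemma integral_mul_fourier_mul_fourierInv {g v ψ : E → ℂ} (hg : Integrable g)
    (hv : Integrable v) (hψ : Integrable ψ) :
    ∫ ξ, g ξ * (𝓕 v ξ * 𝓕⁻ ψ ξ) = ∫ p : E × E, 𝓕⁻ g (p.2 - p.1) * (v p.1 * ψ p.2) := by
  have hint : Integrable (Function.uncurry fun (ξ : E) (p : E × E) ↦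
      𝐞 (inner ℝ ξ (p.2 - p.1)) • (g ξ * (v p.1 * ψ p.2))) := by
    have hprod : Integrable fun q : E × E × E ↦ g q.1 * (v q.2.1 * ψ q.2.2) :=
      hg.mul_prod (hv.mul_prod hψ)
    refine hprod.norm.mono' ?_ (ae_of_all _ fun q ↦ (Circle.norm_smul _ _).le)
    exact (Continuous.aestronglyMeasurable (by fun_prop)).smul hprod.aestronglyMeasurable
  calc ∫ ξ, g ξ * (𝓕 v ξ * 𝓕⁻ ψ ξ)
      = ∫ ξ, ∫ p : E × E, 𝐞 (inner ℝ ξ (p.2 - p.1)) • (g ξ * (v p.1 * ψ p.2)) := by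
        congr 1 with ξ
        rw [fourier_eq, fourierInv_eq, ← integral_prod_mul, ← integral_const_mul]
        congr 1 with p
        rw [inner_sub_right, sub_eq_neg_add, AddChar.map_add_eq_mul, real_inner_comm ξ p.1,
          real_inner_comm ξ p.2]
        simp only [Circle.smul_def, smul_eq_mul, Circle.coe_mul]
        ring
    _ = ∫ p : E × E, ∫ ξ, 𝐞 (inner ℝ ξ (p.2 - p.1)) • (g ξ * (v p.1 * ψ p.2)) :=
        integral_integral_swap hint
    _ = ∫ p : E × E, 𝓕⁻ g (p.2 - p.1) * (v p.1 * ψ p.2) := by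
        congr 1 with p
        rw [fourierInv_eq, ← integral_mul_const]
        simp only [smul_mul_assoc]

lemma integrable_heatSymbol {t : ℝ} (ht : 0 < t) :
    Integrable fun ξ : E ↦ (heatSymbol t ξ : ℂ) := by
  have hre : 0 < ((4 * π ^ 2 * t : ℝ) : ℂ).re := by rw [Complex.ofReal_re]; positivity
  simpa [ofReal_heatSymbol] using
    GaussianFourier.integrable_cexp_neg_mul_sq_norm_add hre 0 (0 : E)

lemma fourierInv_heatSymbol {t : ℝ} (ht : 0 < t) (x : E) :
    𝓕⁻ (fun ξ : E ↦ (heatSymbol t ξ : ℂ)) x = heatKernel (Module.finrank ℝ E) t ‖x‖ := by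
  have hre : 0 < ((4 * π ^ 2 * t : ℝ) : ℂ).re := by rw [Complex.ofReal_re]; positivity
  simp only [ofReal_heatSymbol, fourierInv_eq_fourier_neg]
  rw [fourier_gaussian_innerProductSpace hre, heatKernel, rpow_neg (by positivity),
    ← inv_rpow (by positivity), Complex.ofReal_mul (_ ^ _), Complex.ofReal_cpow (by positivity),
    Complex.ofReal_exp, norm_neg]
  congr 2
  · push_cast; field_simp
  · push_cast; rfl
  · push_cast; field_simp

lemma integral_one_sub_heatSymbol_mul_fourier {t : ℝ} (ht : 0 < t) (v ψ : 𝓢(E, ℂ))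
    (hvψ : ∫ x, v x * ψ x = 0) :
    ∫ ξ, ((1 - heatSymbol t ξ : ℝ) : ℂ) * (𝓕 v ξ * 𝓕⁻ ψ ξ) =
      -∫ p : E × E, (heatKernel (Module.finrank ℝ E) t ‖p.2 - p.1‖ : ℂ) * (v p.1 * ψ p.2) := by
  have hint : Integrable fun ξ ↦ 𝓕 v ξ * 𝓕⁻ ψ ξ :=
    ((𝓕 v).memLp 2).integrable_mul ((𝓕⁻ ψ).memLp 2)
  have hint_heat : Integrable fun ξ ↦ (heatSymbol t ξ : ℂ) * (𝓕 v ξ * 𝓕⁻ ψ ξ) := by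
    refine hint.bdd_mul (c := 1)
      (Complex.continuous_ofReal.comp (continuous_heatSymbol t)).aestronglyMeasurable
      (ae_of_all _ fun ξ ↦ ?_)
    rw [Complex.norm_real, heatSymbol, norm_of_nonneg (exp_nonneg _)]
    exact heatSymbol_le_one ht.le ξ
  have hparseval : ∫ ξ, 𝓕 v ξ * 𝓕⁻ ψ ξ = 0 := by
    rw [SchwartzMap.integral_fourier_mul_eq, FourierTransform.fourier_fourierInv_eq, hvψ]
  have hheat := integral_mul_fourier_mul_fourierInv (integrable_heatSymbol ht) v.integrable
    ψ.integrable
  simp only [fourierInv_heatSymbol ht, ← SchwartzMap.fourier_coe, ← SchwartzMap.fourierInv_coe]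
    at hheat
  simp only [Complex.ofReal_sub, Complex.ofReal_one, sub_mul, one_mul]
  rw [integral_sub hint hint_heat, hparseval, hheat, zero_sub]

lemma IsSeparatedBy.integrable_jumpKernel_mul (n : ℕ) {s : ℝ} (hs0 : 0 < s) (hs1 : s < 1) {δ : ℝ}
    (hδ : 0 < δ) {v ψ : E → ℂ}
    (hsep : IsSeparatedBy δ (Function.support v) (Function.support ψ))
    (hv : Integrable v) (hψ : Integrable ψ) :
    Integrable fun p : E × E ↦ (jumpKernel n s ‖p.2 - p.1‖ : ℂ) * (v p.1 * ψ p.2) := by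
  have hvψ : Integrable fun p : E × E ↦ v p.1 * ψ p.2 := hv.mul_prod hψ
  refine Integrable.mono' (hvψ.norm.const_mul (jumpKernel n s δ)) ?_
    (ae_of_all _ (hsep.norm_jumpKernel_mul_le n hs0 hs1 hδ))
  refine (Complex.measurable_ofReal.comp ?_).aestronglyMeasurable.mul hvψ.aestronglyMeasurable
  exact (measurable_jumpKernel n s).comp (measurable_snd.sub measurable_fst).norm

lemma integral_fracSymbol_mul {s : ℝ} (hs0 : 0 < s) (hs1 : s < 1) {h : E → ℂ}
    (hh : AEStronglyMeasurable h)
    (hint : Integrable fun ξ ↦ (fracSymbol s ξ : ℂ) * h ξ) :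
    ∫ ξ, (fracSymbol s ξ : ℂ) * h ξ = ((s / Gamma (1 - s) : ℝ) : ℂ) *
      ∫ t in Ioi (0 : ℝ), ∫ ξ, (((1 - heatSymbol t ξ) * t ^ (-1 - s) : ℝ) : ℂ) * h ξ := by
  have hκ : ((s / Gamma (1 - s) : ℝ) : ℂ) ≠ 0 := by
    have := Gamma_pos_of_pos (show 0 < 1 - s by linarith)
    exact_mod_cast (by positivity : s / Gamma (1 - s) ≠ 0)
  simp only [fracSymbol_eq_integral hs0 hs1, Complex.ofReal_mul (s / _), mul_assoc] at hint ⊢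
  rw [integral_const_mul, integral_integral_mul_swap_of_nonneg ?_ ?_ ?_ hh
    ((integrable_const_mul_iff hκ.isUnit _).1 hint)]
  · unfold heatSymbol; fun_prop
  · refine fun ξ ↦ (ae_restrict_iff' measurableSet_Ioi).2 (ae_of_all _ fun t (ht : 0 < t) ↦ ?_)
    exact mul_nonneg (sub_nonneg.2 (heatSymbol_le_one ht.le ξ)) (rpow_nonneg ht.le _)
  · exact fun ξ _ ↦ integrableOn_one_sub_heatSymbol_mul_rpow hs0 hs1 ξ

lemma IsSeparatedBy.integral_jumpKernel_mul (n : ℕ) {s : ℝ} (hs0 : 0 < s) (hs1 : s < 1) {δ : ℝ}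
    (hδ : 0 < δ) {v ψ : E → ℂ}
    (hsep : IsSeparatedBy δ (Function.support v) (Function.support ψ))
    (hv : Integrable v) (hψ : Integrable ψ) :
    ∫ p : E × E, (jumpKernel n s ‖p.2 - p.1‖ : ℂ) * (v p.1 * ψ p.2) =
      ((s / Gamma (1 - s) : ℝ) : ℂ) * ∫ t in Ioi (0 : ℝ), ∫ p : E × E,
        ((t ^ (-1 - s) * heatKernel n t ‖p.2 - p.1‖ : ℝ) : ℂ) * (v p.1 * ψ p.2) := by
  have hκ : ((s / Gamma (1 - s) : ℝ) : ℂ) ≠ 0 := by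
    have := Gamma_pos_of_pos (show 0 < 1 - s by linarith)
    exact_mod_cast (by positivity : s / Gamma (1 - s) ≠ 0)
  have hpos {p : E × E} (hp : v p.1 * ψ p.2 ≠ 0) : 0 < ‖p.2 - p.1‖ :=
    hδ.trans_le (hsep.le_norm_sub hp)
  have hkernel (p : E × E) : (jumpKernel n s ‖p.2 - p.1‖ : ℂ) * (v p.1 * ψ p.2) =
      ((s / Gamma (1 - s) : ℝ) : ℂ) *
        (((∫ t in Ioi (0 : ℝ), t ^ (-1 - s) * heatKernel n t ‖p.2 - p.1‖ : ℝ) : ℂ) *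
          (v p.1 * ψ p.2)) := by
    rcases eq_or_ne (v p.1 * ψ p.2) 0 with hp | hp
    · simp [hp]
    · rw [jumpKernel_eq_integral n hs0 (hpos hp), Complex.ofReal_mul, mul_assoc]
  have hint := hsep.integrable_jumpKernel_mul n hs0 hs1 hδ hv hψ
  simp only [hkernel] at hint ⊢
  rw [integral_const_mul, integral_integral_mul_swap_of_nonneg ?_ ?_ ?_ ?_
    ((integrable_const_mul_iff hκ.isUnit _).1 hint)]
  · exact (measurable_fst.pow_const _).mul ((measurable_heatKernel n).comp
      (f := fun q : ℝ × E × E ↦ (q.1, ‖q.2.2 - q.2.1‖)) (by fun_prop))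
  · refine fun p ↦ (ae_restrict_iff' measurableSet_Ioi).2 (ae_of_all _ fun t (ht : 0 < t) ↦ ?_)
    exact mul_nonneg (rpow_nonneg ht.le _) (heatKernel_nonneg n ht.le _)
  · exact fun p hp ↦ integrableOn_rpow_mul_heatKernel n hs0 (hpos hp)
  · exact (hv.mul_prod hψ).aestronglyMeasurable

theorem IsSeparatedBy.integral_fracSymbol_mul_fourier {s : ℝ} (hs0 : 0 < s) (hs1 : s < 1) {δ : ℝ}
    (hδ : 0 < δ) {v ψ : 𝓢(E, ℂ)}
    (hsep : IsSeparatedBy δ (Function.support v) (Function.support ψ))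
    (hint : Integrable fun ξ ↦ (fracSymbol s ξ : ℂ) * (𝓕 v ξ * 𝓕⁻ ψ ξ)) :
    ∫ ξ, (fracSymbol s ξ : ℂ) * (𝓕 v ξ * 𝓕⁻ ψ ξ) =
      -∫ p : E × E, (jumpKernel (Module.finrank ℝ E) s ‖p.2 - p.1‖ : ℂ) * (v p.1 * ψ p.2) := by
  have hvψ : ∫ x, v x * ψ x = 0 := by
    refine integral_eq_zero_of_ae (ae_of_all _ fun x ↦ by_contra fun hx ↦ ?_)
    have := hsep.le_norm_sub (p := (x, x)) hx
    rw [sub_self, norm_zero] at this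
    exact hδ.not_ge this
  rw [integral_fracSymbol_mul hs0 hs1 ?_ hint,
    hsep.integral_jumpKernel_mul _ hs0 hs1 hδ v.integrable ψ.integrable, ← mul_neg, ← integral_neg]
  · congr 1
    refine setIntegral_congr_fun measurableSet_Ioi fun t (ht : 0 < t) ↦ ?_
    simp only [mul_comm _ (t ^ (-1 - s)), Complex.ofReal_mul (t ^ (-1 - s)), mul_assoc]
    rw [integral_const_mul, integral_const_mul, integral_one_sub_heatSymbol_mul_fourier ht v ψ hvψ,
      mul_neg]
  · exact ((𝓕 v).continuous.mul (𝓕⁻ ψ).continuous).aestronglyMeasurable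

end KernelFormula

section FracSymbol

variable {E : Type*} [NormedAddCommGroup E] {s : ℝ}

lemma fracSymbol_neg (s : ℝ) (ξ : E) : fracSymbol s (-ξ) = fracSymbol s ξ := by
  simp [fracSymbol]

lemma fracSymbol_le (hs0 : 0 ≤ s) (hs1 : s ≤ 1) (ξ : E) :
    fracSymbol s ξ ≤ 1 + (2 * π) ^ 2 * ‖ξ‖ ^ 2 := by
  have h0 : 0 ≤ 2 * π * ‖ξ‖ := by positivity
  rw [fracSymbol, ← mul_pow]
  rcases le_total (2 * π * ‖ξ‖) 1 with h | h
  · have := rpow_le_one h0 h (show 0 ≤ 2 * s by linarith)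
    nlinarith [sq_nonneg (2 * π * ‖ξ‖)]
  · have := rpow_le_rpow_of_exponent_le h (show 2 * s ≤ 2 by linarith)
    rw [rpow_two] at this
    linarith

lemma fracSymbol_le_mul_one_add_rpow (hs0 : 0 ≤ s) (ξ : E) :
    fracSymbol s ξ ≤ (2 * π) ^ (2 * s) * (1 + ‖ξ‖ ^ 2) ^ s := by
  rw [fracSymbol, mul_rpow (by positivity) (norm_nonneg _), rpow_mul (norm_nonneg _), rpow_two]
  gcongr
  linarith

variable [InnerProductSpace ℝ E] [FiniteDimensional ℝ E] [MeasurableSpace E] [BorelSpace E]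

lemma memLp_fracSymbol_mul (hs0 : 0 ≤ s) (hs1 : s ≤ 1) (f : 𝓢(E, ℂ)) (p : ℝ≥0∞) :
    MemLp (fun ξ ↦ (fracSymbol s ξ : ℂ) * f ξ) p := by
  have hg : (fun ξ : E ↦ 1 + (2 * π) ^ 2 * ‖ξ‖ ^ 2).HasTemperateGrowth :=
    (Function.HasTemperateGrowth.const (1 : ℝ)).add
      ((Function.HasTemperateGrowth.const ((2 * π) ^ 2 : ℝ)).mul
        (Function.hasTemperateGrowth_norm_sq E))
  refine ((SchwartzMap.smulLeftCLM ℂ (fun ξ : E ↦ 1 + (2 * π) ^ 2 * ‖ξ‖ ^ 2) f).memLp p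
    volume).mono (Continuous.aestronglyMeasurable ?_) (ae_of_all _ fun ξ ↦ ?_)
  · exact (Complex.continuous_ofReal.comp (continuous_fracSymbol hs0)).mul f.continuous
  · rw [SchwartzMap.smulLeftCLM_apply_apply hg, norm_mul, norm_smul, Complex.norm_real,
      norm_of_nonneg (fracSymbol_nonneg s ξ), norm_of_nonneg (by positivity)]
    gcongr
    exact fracSymbol_le hs0 hs1 ξ

lemma continuous_fourier_of_integrable {g : E → ℂ} (hg : Integrable g) : Continuous (𝓕 g) :=
  VectorFourier.fourierIntegral_continuous continuous_fourierChar
    (L := innerₗ E) continuous_inner hg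

lemma norm_fourier_le_integral (g : E → ℂ) (ξ : E) : ‖𝓕 g ξ‖ ≤ ∫ x, ‖g x‖ :=
  VectorFourier.norm_fourierIntegral_le_integral_norm _ _ _ _ _

lemma integral_fourier_mul_eq_flip {g h : E → ℂ} (hg : Integrable g) (hh : Integrable h) :
    ∫ ξ, 𝓕 g ξ * h ξ = ∫ x, g x * 𝓕 h x := by
  have hflip := VectorFourier.integral_fourierIntegral_smul_eq_flip (L := innerₗ E) (μ := volume)
    (ν := volume) continuous_fourierChar continuous_inner hg hh
  rwa [flip_innerₗ] at hflip

lemma integral_fourierInv_mul_eq_flip {g h : E → ℂ} (hg : Integrable g) (hh : Integrable h) :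
    ∫ ξ, 𝓕⁻ g ξ * h ξ = ∫ x, g x * 𝓕⁻ h x := by
  rw [fourierInv_eq_fourier_comp_neg h, ← integral_fourier_mul_eq_flip hg hh.comp_neg,
    ← integral_neg_eq_self fun ξ ↦ 𝓕 g ξ * h (-ξ)]
  simp only [fourierInv_eq_fourier_neg, neg_neg]

lemma conj_fourierInv (g : E → ℂ) (x : E) : conj (𝓕⁻ g x) = 𝓕 (fun ξ ↦ conj (g ξ)) x := by
  rw [fourierInv_eq', fourier_eq', ← integral_conj]
  congr 1 with ξ
  simp only [smul_eq_mul, map_mul, ← Complex.exp_conj, Complex.conj_I, Complex.conj_ofReal]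
  congr 2
  push_cast
  ring

lemma fourierInv_ofReal_eq_conj (ψ : E → ℝ) (ξ : E) :
    𝓕⁻ (fun x ↦ (ψ x : ℂ)) ξ = conj (𝓕 (fun x ↦ (ψ x : ℂ)) ξ) := by
  rw [← Complex.conj_conj (𝓕⁻ (fun x ↦ (ψ x : ℂ)) ξ), conj_fourierInv]
  simp only [Complex.conj_ofReal]

/-- The Fourier transform `|2πξ|^{2s} 𝓕φ` of `(-Δ)^s φ`. -/
def fourierFracLaplacian (s : ℝ) (φ : E → ℝ) (ξ : E) : ℂ :=
  fracSymbol s ξ * 𝓕 (fun x ↦ (φ x : ℂ)) ξ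

lemma conj_fourierFracLaplacian (s : ℝ) (φ : E → ℝ) (ξ : E) :
    conj (fourierFracLaplacian s φ ξ) = fracSymbol s ξ * 𝓕⁻ (fun x ↦ (φ x : ℂ)) ξ := by
  rw [fourierFracLaplacian, map_mul, Complex.conj_ofReal, fourierInv_ofReal_eq_conj]

/-- The function `(-Δ)^s φ`, as an inverse Fourier transform. Its values are real since `φ` is
real and the symbol of `(-Δ)^s` is even. -/
def fracLaplacianFun (s : ℝ) (φ : E → ℝ) (x : E) : ℝ := (𝓕⁻ (fourierFracLaplacian s φ) x).re

lemma ofReal_fracLaplacianFun (s : ℝ) (φ : E → ℝ) (x : E) :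
    (fracLaplacianFun s φ x : ℂ) = 𝓕⁻ (fourierFracLaplacian s φ) x := by
  rw [fracLaplacianFun, ← Complex.conj_eq_iff_re, conj_fourierInv, fourierInv_eq_fourier_comp_neg]
  simp only [conj_fourierFracLaplacian, fourierInv_eq_fourier_neg]
  simp only [fourierFracLaplacian, fracSymbol_neg]

lemma abs_fracLaplacianFun_le (s : ℝ) (φ : E → ℝ) (x : E) :
    |fracLaplacianFun s φ x| ≤ ∫ ξ, ‖fourierFracLaplacian s φ ξ‖ :=
  (Complex.abs_re_le_norm _).trans
    ((fourierInv_eq_fourier_neg (fourierFracLaplacian s φ) x).symm ▸ norm_fourier_le_integral _ _)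

lemma continuous_fracLaplacianFun {φ : E → ℝ} (hφ : Integrable (fourierFracLaplacian s φ)) :
    Continuous (fracLaplacianFun s φ) := by
  have h : 𝓕⁻ (fourierFracLaplacian s φ) = fun x ↦ 𝓕 (fourierFracLaplacian s φ) (-x) :=
    funext fun x ↦ fourierInv_eq_fourier_neg _ x
  unfold fracLaplacianFun
  rw [h]
  exact Complex.continuous_re.comp ((continuous_fourier_of_integrable hφ).comp continuous_neg)

end FracSymbol

variable {d : ℕ}

local notation "𝔼" => EuclideanSpace ℝ (Fin d)

local notation "L²" => Lp ℝ 2 (volume : Measure (EuclideanSpace ℝ (Fin d)))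

section TestFunctions

variable {U V : Set (EuclideanSpace ℝ (Fin d))} {φ ψ : EuclideanSpace ℝ (Fin d) → ℝ} {s : ℝ}

namespace IsTestFunction

lemma eq_zero_of_notMem (hψ : IsTestFunction U ψ) {x : 𝔼} (hx : x ∉ U) : ψ x = 0 :=
  image_eq_zero_of_notMem_tsupport fun h ↦ hx (hψ.2.2 h)

lemma integrable (hψ : IsTestFunction U ψ) : Integrable ψ :=
  hψ.1.continuous.integrable_of_hasCompactSupport hψ.2.1

/-- A test function as a complex-valued Schwartz function. -/
def toSchwartz (hψ : IsTestFunction U ψ) : 𝓢(𝔼, ℂ) :=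
  (hψ.2.1.comp_left (g := ((↑) : ℝ → ℂ)) Complex.ofReal_zero).toSchwartzMap
    (Complex.ofRealCLM.contDiff.comp hψ.1)

lemma coe_toSchwartz (hψ : IsTestFunction U ψ) :
    (hψ.toSchwartz : 𝔼 → ℂ) = fun x ↦ (ψ x : ℂ) := rfl

lemma fourier_toSchwartz (hψ : IsTestFunction U ψ) :
    ((𝓕 hψ.toSchwartz : 𝓢(𝔼, ℂ)) : 𝔼 → ℂ) = 𝓕 (fun x ↦ (ψ x : ℂ)) :=
  SchwartzMap.fourier_coe _

lemma fourierInv_toSchwartz (hψ : IsTestFunction U ψ) :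
    ((𝓕⁻ hψ.toSchwartz : 𝓢(𝔼, ℂ)) : 𝔼 → ℂ) = 𝓕⁻ (fun x ↦ (ψ x : ℂ)) :=
  SchwartzMap.fourierInv_coe _

lemma memLp_fourierFracLaplacian (hφ : IsTestFunction U φ) (hs0 : 0 ≤ s) (hs1 : s ≤ 1)
    (p : ℝ≥0∞) : MemLp (fourierFracLaplacian s φ) p := by
  unfold fourierFracLaplacian
  rw [← hφ.fourier_toSchwartz]
  exact memLp_fracSymbol_mul hs0 hs1 _ p

/-- A test function as an element of `L²`. -/
def toL2 (hψ : IsTestFunction U ψ) : L² :=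
  (hψ.1.continuous.memLp_of_hasCompactSupport hψ.2.1).toLp ψ

lemma coeFn_toL2 (hψ : IsTestFunction U ψ) : hψ.toL2 =ᵐ[volume] ψ :=
  MemLp.coeFn_toLp _

lemma eq_toL2 (hψ : IsTestFunction U ψ) {v : L²}
    (hv : v =ᵐ[volume] ψ) : v = hψ.toL2 :=
  Lp.ext (hv.trans hψ.coeFn_toL2.symm)

end IsTestFunction

end TestFunctions

section Complexify

variable {U : Set (EuclideanSpace ℝ (Fin d))} {ψ : EuclideanSpace ℝ (Fin d) → ℝ}

lemma coeFn_complexify (u : L²) :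
    complexify u =ᵐ[volume] fun x ↦ (u x : ℂ) :=
  Complex.ofRealCLM.coeFn_compLp' u

lemma complexify_add (u v : L²) :
    complexify (u + v) = complexify u + complexify v :=
  map_add (Complex.ofRealCLM.compLpL 2 volume) u v

lemma continuous_complexify : Continuous (complexify : L² → _) :=
  (Complex.ofRealCLM.compLpL 2 (volume : Measure 𝔼)).continuous

lemma norm_fourier_complexify (u : L²) : ‖𝓕 (complexify u)‖ = ‖u‖ := by
  rw [Lp.norm_fourier_eq, Lp.norm_def, Lp.norm_def, eLpNorm_congr_norm_ae (g := u)]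
  filter_upwards [coeFn_complexify u] with x hx
  rw [hx, Complex.norm_real]

lemma enorm_sq_eq_lintegral_fourier (u : L²) :
    ‖u‖ₑ ^ 2 = ∫⁻ ξ, ‖𝓕 (complexify u) ξ‖ₑ ^ 2 := by
  have h := eLpNorm_nnreal_pow_eq_lintegral (μ := (volume : Measure 𝔼)) (p := 2)
    (f := (𝓕 (complexify u) : Lp ℂ 2 (volume : Measure 𝔼))) (by norm_num)
  simp only [NNReal.coe_ofNat, ENNReal.coe_ofNat, ENNReal.rpow_two] at h
  rw [← h, ← Lp.enorm_def, ← ofReal_norm, ← ofReal_norm, norm_fourier_complexify]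

lemma norm_sq_eq_integral_fourier (u : L²) :
    ‖u‖ ^ 2 = ∫ ξ, ‖𝓕 (complexify u) ξ‖ ^ 2 := by
  rw [← toReal_enorm, ← ENNReal.toReal_pow, enorm_sq_eq_lintegral_fourier,
    integral_eq_lintegral_of_nonneg_ae (ae_of_all _ fun _ ↦ sq_nonneg _)
      ((Lp.aestronglyMeasurable _).norm.pow 2)]
  simp only [ENNReal.ofReal_pow (norm_nonneg _), ofReal_norm]

lemma IsTestFunction.coeFn_fourier_complexify_toL2 (hψ : IsTestFunction U ψ) :
    (𝓕 (complexify hψ.toL2) : Lp ℂ 2 (volume : Measure 𝔼)) =ᵐ[volume]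
      𝓕 (fun x ↦ (ψ x : ℂ)) := by
  have h : complexify hψ.toL2 = hψ.toSchwartz.toLp 2 := by
    refine Lp.ext ?_
    filter_upwards [coeFn_complexify hψ.toL2, hψ.coeFn_toL2, hψ.toSchwartz.coeFn_toLp 2]
      with x h1 h2 h3
    rw [h1, h2, h3, hψ.coe_toSchwartz]
  rw [h, SchwartzMap.toLp_fourier_eq, ← hψ.fourier_toSchwartz]
  exact SchwartzMap.coeFn_toLp _ 2 volume

end Complexify

section FracLaplacian

variable {U V : Set (EuclideanSpace ℝ (Fin d))} {φ ψ : EuclideanSpace ℝ (Fin d) → ℝ} {s : ℝ}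

namespace IsTestFunction

lemma fracLaplacian_eq_inner (hψ : IsTestFunction U ψ) (hs0 : 0 ≤ s) (hs1 : s ≤ 1)
    (u : L²) :
    fracLaplacian s u ψ =
      inner ℂ ((hψ.memLp_fourierFracLaplacian hs0 hs1 2).toLp _) (𝓕 (complexify u)) := by
  rw [L2.inner_def, fracLaplacian]
  refine integral_congr_ae ?_
  filter_upwards [(hψ.memLp_fourierFracLaplacian hs0 hs1 2).coeFn_toLp] with ξ hξ
  rw [hξ, RCLike.inner_apply, conj_fourierFracLaplacian, fracSymbol]
  ring

lemma fracLaplacian_add (hψ : IsTestFunction U ψ) (hs0 : 0 ≤ s) (hs1 : s ≤ 1)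
    (u v : L²) :
    fracLaplacian s (u + v) ψ = fracLaplacian s u ψ + fracLaplacian s v ψ := by
  simp only [hψ.fracLaplacian_eq_inner hs0 hs1, complexify_add, FourierTransform.fourier_add,
    inner_add_right]

lemma continuous_fracLaplacian (hψ : IsTestFunction U ψ) (hs0 : 0 ≤ s) (hs1 : s ≤ 1) :
    Continuous fun u : L² ↦ fracLaplacian s u ψ := by
  simp only [hψ.fracLaplacian_eq_inner hs0 hs1]
  exact continuous_const.inner ((Lp.fourierTransformₗᵢ 𝔼 ℂ).continuous.comp continuous_complexify)

lemma norm_fracLaplacian_le (hψ : IsTestFunction U ψ) (hs0 : 0 ≤ s) (hs1 : s ≤ 1)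
    (u : L²) :
    ‖fracLaplacian s u ψ‖ ≤ (eLpNorm (fourierFracLaplacian s ψ) 2).toReal * ‖u‖ := by
  rw [hψ.fracLaplacian_eq_inner hs0 hs1, ← norm_fourier_complexify u,
    ← Lp.norm_toLp _ (hψ.memLp_fourierFracLaplacian hs0 hs1 2)]
  exact norm_inner_le_norm _ _

lemma fracLaplacian_toL2 (hφ : IsTestFunction U φ) (s : ℝ) (ψ : 𝔼 → ℝ) :
    fracLaplacian s hφ.toL2 ψ =
      ∫ ξ, fourierFracLaplacian s φ ξ * 𝓕⁻ (fun x ↦ (ψ x : ℂ)) ξ := by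
  refine integral_congr_ae ?_
  filter_upwards [hφ.coeFn_fourier_complexify_toL2] with ξ hξ
  rw [hξ, fourierFracLaplacian, fracSymbol]

lemma fracLaplacian_toL2_comm (hφ : IsTestFunction U φ) (hψ : IsTestFunction V ψ) (s : ℝ) :
    fracLaplacian s hφ.toL2 ψ = conj (fracLaplacian s hψ.toL2 φ) := by
  rw [fracLaplacian_toL2, fracLaplacian_toL2, ← integral_conj]
  congr 1 with ξ
  rw [map_mul, conj_fourierFracLaplacian, fourierFracLaplacian, fourierInv_ofReal_eq_conj φ,
    Complex.conj_conj]
  ring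

lemma fracLaplacian_toL2_eq_integral (hφ : IsTestFunction U φ) (hs0 : 0 ≤ s) (hs1 : s ≤ 1)
    (hψ : Integrable ψ) :
    fracLaplacian s hφ.toL2 ψ = ((∫ x, fracLaplacianFun s φ x * ψ x : ℝ) : ℂ) := by
  rw [← integral_complex_ofReal, fracLaplacian_toL2, ← integral_fourierInv_mul_eq_flip
    (memLp_one_iff_integrable.1 (hφ.memLp_fourierFracLaplacian hs0 hs1 1))
    (h := fun x ↦ (ψ x : ℂ)) hψ.ofReal]
  simp only [Complex.ofReal_mul, ofReal_fracLaplacianFun]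

end IsTestFunction

end FracLaplacian

section Sobolev

variable {s : ℝ} {Ω : Set (EuclideanSpace ℝ (Fin d))}
  {w : Lp ℝ 2 (volume : Measure (EuclideanSpace ℝ (Fin d)))}

lemma enorm_sq_le_sobolevNormSq (hs0 : 0 ≤ s) (u : L²) :
    ‖u‖ₑ ^ 2 ≤ sobolevNormSq s u := by
  rw [enorm_sq_eq_lintegral_fourier, sobolevNormSq]
  refine lintegral_mono fun ξ ↦ le_mul_of_one_le_left zero_le ?_
  rw [← ENNReal.ofReal_one]
  exact ENNReal.ofReal_le_ofReal (one_le_rpow (by nlinarith [sq_nonneg ‖ξ‖]) hs0)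

lemma tendsto_of_tendsto_sobolevNormSq (hs0 : 0 ≤ s) {v : ℕ → L²}
    (h : Tendsto (fun n ↦ sobolevNormSq s (w - v n)) atTop (𝓝 0)) : Tendsto v atTop (𝓝 w) := by
  have hsq : Tendsto (fun n ↦ ‖w - v n‖ₑ ^ 2) atTop (𝓝 0) :=
    tendsto_of_tendsto_of_tendsto_of_le_of_le tendsto_const_nhds h (fun _ ↦ zero_le)
      fun n ↦ enorm_sq_le_sobolevNormSq hs0 _
  have hsqrt := ((ENNReal.tendsto_toReal ENNReal.zero_ne_top).comp hsq).sqrt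
  rw [tendsto_iff_norm_sub_tendsto_zero]
  simpa [Function.comp_def, sqrt_sq, norm_sub_rev] using hsqrt

lemma MemHTilde.exists_seq (hw : MemHTilde s Ω w) :
    ∃ (χ : ℕ → 𝔼 → ℝ) (hχ : ∀ n, IsTestFunction Ω (χ n)),
      Tendsto (fun n ↦ sobolevNormSq s (w - (hχ n).toL2)) atTop (𝓝 0) := by
  have h (n : ℕ) : ∃ (ψ : 𝔼 → ℝ) (hψ : IsTestFunction Ω ψ),
      sobolevNormSq s (w - hψ.toL2) < (n : ℝ≥0∞)⁻¹ := by
    obtain ⟨ψ, v, hψ, hv, hlt⟩ := hw.2 _ (ENNReal.inv_pos.2 (ENNReal.natCast_ne_top n))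
    exact ⟨ψ, hψ, hψ.eq_toL2 hv ▸ hlt⟩
  choose χ hχ hlt using h
  exact ⟨χ, hχ, tendsto_of_tendsto_of_tendsto_of_le_of_le tendsto_const_nhds
    ENNReal.tendsto_inv_nat_nhds_zero (fun _ ↦ zero_le) fun n ↦ (hlt n).le⟩

end Sobolev

section JumpPotential

variable {E : Type*} [NormedAddCommGroup E] [InnerProductSpace ℝ E] [FiniteDimensional ℝ E]
  [MeasurableSpace E] [BorelSpace E] {s δ : ℝ} {v ψ : E → ℝ}

/-- The potential of `v` for the jump kernel. Away from the support of `v`, it is `-(-Δ)^s v`. -/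
def jumpPotential (s : ℝ) (v : E → ℝ) (x : E) : ℝ :=
  ∫ y, jumpKernel (Module.finrank ℝ E) s ‖x - y‖ * v y

lemma aestronglyMeasurable_jumpPotential (s : ℝ) (hv : AEStronglyMeasurable v) :
    AEStronglyMeasurable (jumpPotential s v) :=
  AEStronglyMeasurable.integral_prod_right' (f := fun p : E × E ↦
    jumpKernel (Module.finrank ℝ E) s ‖p.1 - p.2‖ * v p.2)
    (((measurable_jumpKernel _ s).comp (by fun_prop)).aestronglyMeasurable.mul hv.comp_snd)

lemma IsSeparatedBy.abs_jumpPotential_le {B : Set E} (hs0 : 0 < s) (hs1 : s < 1) (hδ : 0 < δ)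
    (hsep : IsSeparatedBy δ (Function.support v) B) (hv : Integrable v) {x : E} (hx : x ∈ B) :
    |jumpPotential s v x| ≤ jumpKernel (Module.finrank ℝ E) s δ * ∫ y, ‖v y‖ := by
  rw [jumpPotential, ← integral_const_mul, ← norm_eq_abs]
  refine norm_integral_le_of_norm_le (hv.norm.const_mul _) (ae_of_all _ fun y ↦ ?_)
  by_cases hy : v y = 0
  · simp [hy]
  · rw [norm_mul, norm_of_nonneg (jumpKernel_nonneg _ hs0 hs1 (norm_nonneg _)), ← dist_eq_norm,
      dist_comm]
    exact mul_le_mul_of_nonneg_right (jumpKernel_le_jumpKernel _ hs0 hs1 hδ (hsep y hy x hx))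
      (norm_nonneg _)

lemma IsSeparatedBy.memLp_jumpPotential {B : Set E} (hs0 : 0 < s) (hs1 : s < 1) (hδ : 0 < δ)
    (hB : MeasurableSet B) (hBfin : volume B ≠ ⊤) (hsep : IsSeparatedBy δ (Function.support v) B)
    (hv : Integrable v) (p : ℝ≥0∞) : MemLp (jumpPotential s v) p (volume.restrict B) := by
  have : IsFiniteMeasure (volume.restrict B) := isFiniteMeasure_restrict.2 hBfin
  refine .of_bound (aestronglyMeasurable_jumpPotential s hv.aestronglyMeasurable).restrict
    (jumpKernel (Module.finrank ℝ E) s δ * ∫ y, ‖v y‖) ?_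
  filter_upwards [ae_restrict_mem hB] with x hx
  exact hsep.abs_jumpPotential_le hs0 hs1 hδ hv hx

lemma IsSeparatedBy.integrable_jumpKernel_mul_real (n : ℕ) (hs0 : 0 < s) (hs1 : s < 1) (hδ : 0 < δ)
    (hsep : IsSeparatedBy δ (Function.support v) (Function.support ψ))
    (hv : Integrable v) (hψ : Integrable ψ) :
    Integrable fun p : E × E ↦ jumpKernel n s ‖p.2 - p.1‖ * (v p.1 * ψ p.2) := by
  have hsep' : IsSeparatedBy δ (Function.support fun x ↦ (v x : ℂ))
      (Function.support fun x ↦ (ψ x : ℂ)) := by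
    simpa only [IsSeparatedBy, Function.mem_support, ne_eq, Complex.ofReal_eq_zero] using hsep
  simpa using! (hsep'.integrable_jumpKernel_mul n hs0 hs1 hδ hv.ofReal hψ.ofReal).re

lemma IsSeparatedBy.integral_jumpKernel_mul_eq (hs0 : 0 < s) (hs1 : s < 1) (hδ : 0 < δ)
    (hsep : IsSeparatedBy δ (Function.support v) (Function.support ψ))
    (hv : Integrable v) (hψ : Integrable ψ) :
    ∫ p : E × E, jumpKernel (Module.finrank ℝ E) s ‖p.2 - p.1‖ * (v p.1 * ψ p.2) =
      ∫ x, jumpPotential s v x * ψ x := by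
  rw [Measure.volume_eq_prod,
    integral_prod_symm _ (hsep.integrable_jumpKernel_mul_real _ hs0 hs1 hδ hv hψ)]
  simp only [jumpPotential, ← mul_assoc, integral_mul_const]

lemma IsSeparatedBy.integral_jumpPotential_mul_comm (hs0 : 0 < s) (hs1 : s < 1) (hδ : 0 < δ)
    (hsep : IsSeparatedBy δ (Function.support v) (Function.support ψ))
    (hv : Integrable v) (hψ : Integrable ψ) :
    ∫ x, jumpPotential s v x * ψ x = ∫ y, jumpPotential s ψ y * v y := by
  rw [← hsep.integral_jumpKernel_mul_eq hs0 hs1 hδ hv hψ, Measure.volume_eq_prod,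
    integral_prod _ (hsep.integrable_jumpKernel_mul_real _ hs0 hs1 hδ hv hψ)]
  simp only [jumpPotential, ← integral_mul_const, mul_assoc, mul_comm (v _), norm_sub_rev]

lemma IsSeparatedBy.integrable_jumpPotential_mul (hs0 : 0 < s) (hs1 : s < 1) (hδ : 0 < δ)
    (hsep : IsSeparatedBy δ (Function.support v) (Function.support ψ))
    (hv : Integrable v) (hψ : Integrable ψ) : Integrable fun x ↦ jumpPotential s v x * ψ x := by
  refine (hsep.integrable_jumpKernel_mul_real (Module.finrank ℝ E) hs0 hs1 hδ hv
    hψ).integral_prod_right.congr (ae_of_all _ fun x ↦ ?_)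
  simp only [jumpPotential, ← mul_assoc, integral_mul_const]

end JumpPotential

section RestrictedLp

variable {α : Type*} [MeasurableSpace α] {μ : Measure α} {Ω : Set α}

lemma integrable_indicator_coeFn_Lp (hΩ : MeasurableSet Ω) (hΩfin : μ Ω ≠ ⊤) (w : Lp ℝ 2 μ) :
    Integrable (Ω.indicator w) μ := by
  have : IsFiniteMeasure (μ.restrict Ω) := isFiniteMeasure_restrict.2 hΩfin
  exact (integrable_indicator_iff hΩ).2 (((Lp.memLp w).restrict Ω).integrable one_le_two)

lemma integral_norm_indicator_coeFn_Lp_le (hΩ : MeasurableSet Ω) (hΩfin : μ Ω ≠ ⊤)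
    (w : Lp ℝ 2 μ) : ∫ x, ‖Ω.indicator w x‖ ∂μ ≤ √(μ Ω).toReal * ‖w‖ := by
  have hw := (Lp.aestronglyMeasurable w).restrict (s := Ω)
  have hle : eLpNorm w 1 (μ.restrict Ω) ≤ μ Ω ^ (1 / 2 : ℝ) * ‖w‖ₑ := by
    calc eLpNorm w 1 (μ.restrict Ω)
        ≤ eLpNorm w 2 (μ.restrict Ω) * μ.restrict Ω univ ^ (1 / (1 : ℝ) - 1 / 2) := by
          simpa using eLpNorm_le_eLpNorm_mul_rpow_measure_univ (p := 1) (q := 2) (by norm_num) hw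
      _ ≤ ‖w‖ₑ * μ Ω ^ (1 / 2 : ℝ) := by
          rw [Measure.restrict_apply_univ, Lp.enorm_def]
          norm_num
          gcongr
          exact Measure.restrict_le_self
      _ = μ Ω ^ (1 / 2 : ℝ) * ‖w‖ₑ := mul_comm _ _
  simp only [norm_indicator_eq_indicator_norm]
  rw [integral_indicator hΩ, integral_norm_eq_lintegral_enorm hw, ← eLpNorm_one_eq_lintegral_enorm,
    sqrt_eq_rpow, ENNReal.toReal_rpow, ← toReal_enorm w, ← ENNReal.toReal_mul]
  exact ENNReal.toReal_mono (ENNReal.mul_ne_top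
    (ENNReal.rpow_ne_top_of_nonneg (by norm_num) hΩfin) enorm_ne_top) hle

lemma continuous_setIntegral_mul_coeFn_Lp {g : α → ℝ} (hg : MemLp g 2 (μ.restrict Ω)) :
    Continuous fun w : Lp ℝ 2 μ ↦ ∫ x in Ω, g x * w x ∂μ := by
  have h (w : Lp ℝ 2 μ) : ∫ x in Ω, g x * w x ∂μ =
      inner ℝ (hg.toLp g) (LpToLpRestrictCLM α ℝ ℝ μ 2 Ω w) := by
    rw [L2.inner_def]
    refine integral_congr_ae ?_
    filter_upwards [hg.coeFn_toLp, LpToLpRestrictCLM_coeFn ℝ Ω w] with x h1 h2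
    rw [h1, h2, RCLike.inner_apply, conj_trivial, mul_comm]
  simp only [h]
  fun_prop

end RestrictedLp

section HTilde

variable {s δ : ℝ} {Ω D : Set (EuclideanSpace ℝ (Fin d))} {χ ψ : EuclideanSpace ℝ (Fin d) → ℝ}
  {w : Lp ℝ 2 (volume : Measure (EuclideanSpace ℝ (Fin d)))}

lemma IsTestFunction.support_subset (hψ : IsTestFunction D ψ) : Function.support ψ ⊆ D :=
  (subset_tsupport ψ).trans hψ.2.2

lemma IsTestFunction.setIntegral_mul (hψ : IsTestFunction D ψ) (g : 𝔼 → ℝ) :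
    ∫ x in D, g x * ψ x = ∫ x, g x * ψ x :=
  setIntegral_eq_integral_of_forall_compl_eq_zero fun x hx ↦ by
    rw [hψ.eq_zero_of_notMem hx, mul_zero]

lemma IsTestFunction.fracLaplacian_toL2_eq_neg_integral (hs0 : 0 < s) (hs1 : s < 1) (hδ : 0 < δ)
    (hsep : IsSeparatedBy δ Ω D) (hχ : IsTestFunction Ω χ) (hψ : IsTestFunction D ψ) :
    fracLaplacian s hχ.toL2 ψ = ((-∫ x, jumpPotential s χ x * ψ x : ℝ) : ℂ) := by
  have hsupp : IsSeparatedBy δ (Function.support χ) (Function.support ψ) :=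
    hsep.mono hχ.support_subset hψ.support_subset
  have hsupp' : IsSeparatedBy δ (Function.support hχ.toSchwartz)
      (Function.support hψ.toSchwartz) := by
    simpa only [IsSeparatedBy, Function.mem_support, ne_eq, coe_toSchwartz,
      Complex.ofReal_eq_zero] using hsupp
  have hformula := hsupp'.integral_fracSymbol_mul_fourier hs0 hs1 hδ ?_
  · rw [hχ.fourier_toSchwartz, hψ.fourierInv_toSchwartz] at hformula
    rw [fracLaplacian_toL2, ← hsupp.integral_jumpKernel_mul_eq hs0 hs1 hδ hχ.integrable
      hψ.integrable, Complex.ofReal_neg, ← integral_complex_ofReal]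
    simpa only [fourierFracLaplacian, mul_assoc, coe_toSchwartz, Complex.ofReal_mul] using hformula
  · rw [hχ.fourier_toSchwartz]
    simpa only [Pi.mul_def, fourierFracLaplacian, mul_assoc] using
      (hχ.memLp_fourierFracLaplacian hs0.le hs1.le 2).integrable_mul
        ((𝓕⁻ hψ.toSchwartz).memLp 2 volume)

lemma MemHTilde.fracLaplacian_eq_neg_integral (hs0 : 0 < s) (hs1 : s < 1) (hδ : 0 < δ)
    (hΩ : MeasurableSet Ω) (hΩfin : volume Ω ≠ ⊤) (hsep : IsSeparatedBy δ Ω D)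
    (hw : MemHTilde s Ω w) (hψ : IsTestFunction D ψ) :
    fracLaplacian s w ψ = ((-∫ x, jumpPotential s (Ω.indicator w) x * ψ x : ℝ) : ℂ) := by
  obtain ⟨χ, hχ, hlim⟩ := hw.exists_seq
  have hψΩ : MemLp (jumpPotential s ψ) 2 (volume.restrict Ω) :=
    (hsep.symm.mono hψ.support_subset subset_rfl).memLp_jumpPotential hs0 hs1 hδ hΩ hΩfin
      hψ.integrable 2
  have hχ_eq (n : ℕ) : fracLaplacian s (hχ n).toL2 ψ =
      ((-∫ x in Ω, jumpPotential s ψ x * (hχ n).toL2 x : ℝ) : ℂ) := by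
    rw [(hχ n).fracLaplacian_toL2_eq_neg_integral hs0 hs1 hδ hsep hψ,
      (hsep.mono (hχ n).support_subset hψ.support_subset).integral_jumpPotential_mul_comm hs0 hs1
        hδ (hχ n).integrable hψ.integrable, ← (hχ n).setIntegral_mul]
    congr 2
    exact integral_congr_ae
      ((ae_restrict_of_ae (hχ n).coeFn_toL2).mono fun x hx ↦ by simp only [hx])
  have hconv := tendsto_of_tendsto_sobolevNormSq hs0.le hlim
  have hw_eq : fracLaplacian s w ψ = ((-∫ x in Ω, jumpPotential s ψ x * w x : ℝ) : ℂ) :=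
    tendsto_nhds_unique (((hψ.continuous_fracLaplacian hs0.le hs1.le).tendsto w).comp hconv)
      ((((Complex.continuous_ofReal.comp (continuous_setIntegral_mul_coeFn_Lp hψΩ).neg).tendsto
        w).comp hconv).congr fun n ↦ (hχ_eq n).symm)
  rw [hw_eq, (hsep.mono support_indicator_subset
    hψ.support_subset).integral_jumpPotential_mul_comm hs0 hs1 hδ
      (integrable_indicator_coeFn_Lp hΩ hΩfin w) hψ.integrable, ← integral_indicator hΩ]
  simp only [indicator_mul_right]

end HTilde

section FracEnergy

variable {s : ℝ} {Ω U : Set (EuclideanSpace ℝ (Fin d))} {φ χ : EuclideanSpace ℝ (Fin d) → ℝ}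
  {z : Lp ℝ 2 (volume : Measure (EuclideanSpace ℝ (Fin d)))}

/-- The quadratic form `∫ |2πξ|^{2s} |𝓕z|² = ⟨(-Δ)^s z, z⟩` of `(-Δ)^s`. It is infinite for `z`
outside `H^s`, where this real-valued integral is `0`. -/
def fracEnergy (s : ℝ) (z : L²) : ℝ :=
  ∫ ξ, fracSymbol s ξ * ‖𝓕 (complexify z) ξ‖ ^ 2

lemma lintegral_fracSymbol_mul_le (hs0 : 0 ≤ s) (z : L²) :
    ∫⁻ ξ, ENNReal.ofReal (fracSymbol s ξ * ‖𝓕 (complexify z) ξ‖ ^ 2) ≤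
      ENNReal.ofReal ((2 * π) ^ (2 * s)) * sobolevNormSq s z := by
  rw [sobolevNormSq, ← lintegral_const_mul' _ _ ENNReal.ofReal_ne_top]
  refine lintegral_mono fun ξ ↦ ?_
  rw [ENNReal.ofReal_mul (fracSymbol_nonneg s ξ), ENNReal.ofReal_pow (norm_nonneg _),
    ofReal_norm, ← mul_assoc, ← ENNReal.ofReal_mul (by positivity)]
  gcongr
  exact fracSymbol_le_mul_one_add_rpow hs0 ξ

lemma aestronglyMeasurable_fracEnergy (hs0 : 0 ≤ s) (z : L²) :
    AEStronglyMeasurable fun ξ ↦ fracSymbol s ξ * ‖𝓕 (complexify z) ξ‖ ^ 2 :=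
  (continuous_fracSymbol hs0).aestronglyMeasurable.mul ((Lp.aestronglyMeasurable _).norm.pow 2)

lemma integrable_fracEnergy (hs0 : 0 ≤ s) (hz : sobolevNormSq s z ≠ ⊤) :
    Integrable fun ξ ↦ fracSymbol s ξ * ‖𝓕 (complexify z) ξ‖ ^ 2 := by
  refine ⟨aestronglyMeasurable_fracEnergy hs0 z, ?_⟩
  rw [hasFiniteIntegral_iff_ofReal (ae_of_all _ fun ξ ↦
    mul_nonneg (fracSymbol_nonneg s ξ) (sq_nonneg _))]
  exact (lintegral_fracSymbol_mul_le hs0 z).trans_lt (ENNReal.mul_lt_top ENNReal.ofReal_lt_top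
    hz.lt_top)

lemma fracEnergy_le (hs0 : 0 ≤ s) (hz : sobolevNormSq s z ≠ ⊤) :
    fracEnergy s z ≤ (2 * π) ^ (2 * s) * (sobolevNormSq s z).toReal := by
  rw [fracEnergy, integral_eq_lintegral_of_nonneg_ae (ae_of_all _ fun ξ ↦
      mul_nonneg (fracSymbol_nonneg s ξ) (sq_nonneg _)) (aestronglyMeasurable_fracEnergy hs0 z),
    ← ENNReal.toReal_ofReal (show 0 ≤ (2 * π) ^ (2 * s) by positivity), ← ENNReal.toReal_mul]
  exact ENNReal.toReal_mono (ENNReal.mul_ne_top ENNReal.ofReal_ne_top hz)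
    (lintegral_fracSymbol_mul_le hs0 z)

namespace IsTestFunction

lemma integrable_fracEnergy_toL2 (hχ : IsTestFunction U χ) (hs0 : 0 ≤ s) (hs1 : s ≤ 1) :
    Integrable fun ξ ↦ fracSymbol s ξ * ‖𝓕 (complexify hχ.toL2) ξ‖ ^ 2 := by
  refine ((hχ.memLp_fourierFracLaplacian hs0 hs1 2).integrable_mul
    (Lp.memLp (𝓕 (complexify hχ.toL2)))).norm.congr ?_
  filter_upwards [hχ.coeFn_fourier_complexify_toL2] with ξ hξ
  rw [Pi.mul_apply, norm_mul, fourierFracLaplacian, norm_mul, hξ, Complex.norm_real,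
    norm_of_nonneg (fracSymbol_nonneg s ξ)]
  ring

lemma fracLaplacian_toL2_self (hχ : IsTestFunction U χ) (s : ℝ) :
    fracLaplacian s hχ.toL2 χ = (fracEnergy s hχ.toL2 : ℂ) := by
  rw [fracLaplacian_toL2, fracEnergy, ← integral_complex_ofReal]
  refine integral_congr_ae ?_
  filter_upwards [hχ.coeFn_fourier_complexify_toL2] with ξ hξ
  rw [hξ, fourierInv_ofReal_eq_conj, fourierFracLaplacian, mul_assoc, Complex.mul_conj,
    Complex.normSq_eq_norm_sq, Complex.ofReal_mul]

lemma two_mul_norm_fracLaplacian_le (hχ : IsTestFunction U χ) (hs0 : 0 ≤ s) (hs1 : s ≤ 1)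
    (hz : sobolevNormSq s z ≠ ⊤) :
    2 * ‖fracLaplacian s z χ‖ ≤ fracEnergy s z + fracEnergy s hχ.toL2 := by
  have hzint := integrable_fracEnergy hs0 hz
  have hχint := hχ.integrable_fracEnergy_toL2 hs0 hs1
  rw [fracEnergy, fracEnergy, ← integral_add hzint hχint, ← le_div_iff₀' two_pos,
    ← integral_div]
  refine norm_integral_le_of_norm_le ((hzint.add hχint).div_const 2) ?_
  filter_upwards [hχ.coeFn_fourier_complexify_toL2] with ξ hξ
  have hσ := fracSymbol_nonneg s ξ
  rw [hξ, norm_mul, norm_mul, Complex.norm_real, ← fracSymbol, norm_of_nonneg hσ,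
    fourierInv_ofReal_eq_conj, RCLike.norm_conj]
  nlinarith [mul_nonneg hσ
    (sq_nonneg (‖𝓕 (complexify z) ξ‖ - ‖𝓕 (fun x ↦ (χ x : ℂ)) ξ‖))]

lemma fracEnergy_toL2_le (hφ : IsTestFunction U φ) (hχ : IsTestFunction Ω χ) (hs0 : 0 ≤ s)
    (hs1 : s ≤ 1) {u : L²} {a : ℝ} (hu : sobolevNormSq s (u - hφ.toL2 - hχ.toL2) ≠ ⊤)
    (heq : fracLaplacian s u χ + (a : ℂ) = 0) :
    fracEnergy s hχ.toL2 ≤ 2 * (eLpNorm (fourierFracLaplacian s φ) 2).toReal * ‖hχ.toL2‖ +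
      fracEnergy s (u - hφ.toL2 - hχ.toL2) - 2 * a := by
  set z := u - hφ.toL2 - hχ.toL2 with hz
  have hsplit : fracLaplacian s u χ =
      fracLaplacian s hφ.toL2 χ + fracEnergy s hχ.toL2 + fracLaplacian s z χ := by
    rw [← hχ.fracLaplacian_toL2_self, ← hχ.fracLaplacian_add hs0 hs1,
      ← hχ.fracLaplacian_add hs0 hs1, hz]
    congr 1
    abel
  have hφχ : ‖fracLaplacian s hφ.toL2 χ‖ ≤
      (eLpNorm (fourierFracLaplacian s φ) 2).toReal * ‖hχ.toL2‖ := by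
    rw [hφ.fracLaplacian_toL2_comm hχ, RCLike.norm_conj]
    exact hφ.norm_fracLaplacian_le hs0 hs1 _
  have hzχ := hχ.two_mul_norm_fracLaplacian_le hs0 hs1 hu
  rw [hsplit] at heq
  have hre := congrArg Complex.re heq
  simp only [Complex.add_re, Complex.ofReal_re, Complex.zero_re] at hre
  linarith [neg_le_of_abs_le (Complex.abs_re_le_norm (fracLaplacian s hφ.toL2 χ)),
    neg_le_of_abs_le (Complex.abs_re_le_norm (fracLaplacian s z χ))]

end IsTestFunction

end FracEnergy

section Poincare

variable {s : ℝ} {Ω : Set (EuclideanSpace ℝ (Fin d))} {χ : EuclideanSpace ℝ (Fin d) → ℝ}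

lemma integral_norm_sq_le_of_norm_sq_le {E : Type*} [NormedAddCommGroup E] [NormedSpace ℝ E]
    [FiniteDimensional ℝ E] [MeasurableSpace E] [BorelSpace E] {μ : Measure E}
    [IsFiniteMeasureOnCompacts μ] (hs0 : 0 ≤ s) {F : E → ℂ} {M R : ℝ} (hR : 0 < R)
    (hFM : ∀ᵐ ξ ∂μ, ‖F ξ‖ ^ 2 ≤ M) (hF : Integrable (fun ξ ↦ ‖F ξ‖ ^ 2) μ)
    (hσF : Integrable (fun ξ ↦ fracSymbol s ξ * ‖F ξ‖ ^ 2) μ) :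
    ∫ ξ, ‖F ξ‖ ^ 2 ∂μ ≤ (μ (Metric.ball 0 R)).toReal * M +
      (2 * π * R) ^ (-(2 * s)) * ∫ ξ, fracSymbol s ξ * ‖F ξ‖ ^ 2 ∂μ := by
  have hball : Integrable ((Metric.ball (0 : E) R).indicator fun _ ↦ M) μ :=
    (integrable_indicator_iff measurableSet_ball).2 (integrableOn_const measure_ball_lt_top.ne)
  have hlow_high : ∀ᵐ ξ ∂μ, ‖F ξ‖ ^ 2 ≤ (Metric.ball (0 : E) R).indicator (fun _ ↦ M) ξ +
      (2 * π * R) ^ (-(2 * s)) * (fracSymbol s ξ * ‖F ξ‖ ^ 2) := by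
    filter_upwards [hFM] with ξ hξ
    have hσ := fracSymbol_nonneg s ξ
    by_cases h : ξ ∈ Metric.ball 0 R
    · rw [indicator_of_mem h]
      exact hξ.trans (le_add_of_nonneg_right (by positivity))
    · rw [indicator_of_notMem h, zero_add, ← mul_assoc, rpow_neg (by positivity), inv_mul_eq_div]
      refine le_mul_of_one_le_left (sq_nonneg _) ((one_le_div (by positivity)).2 ?_)
      have hRξ : R ≤ ‖ξ‖ := by simpa using h
      unfold fracSymbol
      gcongr
  refine (integral_mono_ae hF (hball.add (hσF.const_mul _)) hlow_high).trans_eq ?_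
  rw [integral_add' hball (hσF.const_mul _), integral_indicator measurableSet_ball,
    setIntegral_const, integral_const_mul, smul_eq_mul, measureReal_def]

/-- The Poincaré constant of `(-Δ)^s` on sets of measure `m` in `ℝ^d`. The radius
`(2 |B₁| m)^(-1/d)`, for which it is `2 (2πR)^(-2s)`, is the one for which the ball of radius `R`
has measure `1 / (2 m)`. -/
def poincareConst (d : ℕ) (s m : ℝ) : ℝ :=
  2 * (2 * π) ^ (-(2 * s)) *
    (2 * (volume (Metric.ball (0 : EuclideanSpace ℝ (Fin d)) 1)).toReal * m) ^ (2 * s / d)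

lemma poincareConst_nonneg {m : ℝ} (hm : 0 ≤ m) : 0 ≤ poincareConst d s m := by
  unfold poincareConst
  positivity

lemma exists_ball_volume_mul_eq_half (hd : 1 ≤ d) (s : ℝ) {m : ℝ} (hm : 0 < m) :
    ∃ R > 0, (volume (Metric.ball (0 : 𝔼) R)).toReal * m = 1 / 2 ∧
      2 * (2 * π * R) ^ (-(2 * s)) = poincareConst d s m := by
  have hd0 : (d : ℝ) ≠ 0 := by positivity
  set V := (volume (Metric.ball (0 : 𝔼) 1)).toReal with hV
  have hV0 : 0 < V :=
    ENNReal.toReal_pos (Metric.measure_ball_pos _ _ one_pos).ne' measure_ball_lt_top.ne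
  have hR0 : 0 < (2 * V * m) ^ (-(1 / d : ℝ)) := by positivity
  refine ⟨_, hR0, ?_, ?_⟩
  · rw [Measure.addHaar_ball_of_pos _ _ hR0, finrank_euclideanSpace_fin, ENNReal.toReal_mul,
      ENNReal.toReal_ofReal (by positivity), ← hV, ← rpow_natCast, ← rpow_mul (by positivity),
      neg_mul, one_div_mul_cancel hd0, rpow_neg_one]
    field_simp
  · rw [poincareConst, ← hV, mul_rpow (by positivity) hR0.le, ← rpow_mul (by positivity),
      ← mul_assoc]
    congr 2
    ring

namespace IsTestFunction

lemma norm_fourier_sq_le (hχ : IsTestFunction Ω χ) (hΩ : MeasurableSet Ω)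
    (hΩfin : volume Ω ≠ ⊤) (ξ : 𝔼) :
    ‖𝓕 (fun x ↦ (χ x : ℂ)) ξ‖ ^ 2 ≤ (volume Ω).toReal * ‖hχ.toL2‖ ^ 2 := by
  have hL1 : ∫ x, ‖(χ x : ℂ)‖ ≤ √(volume Ω).toReal * ‖hχ.toL2‖ := by
    refine (integral_congr_ae ?_).trans_le
      (integral_norm_indicator_coeFn_Lp_le hΩ hΩfin hχ.toL2)
    filter_upwards [hχ.coeFn_toL2] with x hx
    by_cases h : x ∈ Ω
    · rw [indicator_of_mem h, hx, Complex.norm_real]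
    · rw [indicator_of_notMem h, hχ.eq_zero_of_notMem h, Complex.ofReal_zero, norm_zero, norm_zero]
  have hsq := pow_le_pow_left₀ (norm_nonneg _) ((norm_fourier_le_integral _ ξ).trans hL1) 2
  rwa [mul_pow, sq_sqrt ENNReal.toReal_nonneg] at hsq

lemma norm_toL2_sq_le_poincareConst_mul (hχ : IsTestFunction Ω χ) (hd : 1 ≤ d) (hs0 : 0 ≤ s)
    (hs1 : s ≤ 1) (hΩ : MeasurableSet Ω) (hΩfin : volume Ω ≠ ⊤) :
    ‖hχ.toL2‖ ^ 2 ≤ poincareConst d s (volume Ω).toReal * fracEnergy s hχ.toL2 := by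
  set m := (volume Ω).toReal with hm
  have henergy : 0 ≤ fracEnergy s hχ.toL2 :=
    integral_nonneg fun ξ ↦ mul_nonneg (fracSymbol_nonneg s ξ) (sq_nonneg _)
  have hFM : ∀ᵐ ξ, ‖𝓕 (complexify hχ.toL2) ξ‖ ^ 2 ≤ m * ‖hχ.toL2‖ ^ 2 := by
    filter_upwards [hχ.coeFn_fourier_complexify_toL2] with ξ hξ
    exact hξ ▸ hχ.norm_fourier_sq_le hΩ hΩfin ξ
  obtain hm0 | hm0 : 0 = m ∨ 0 < m := ENNReal.toReal_nonneg.eq_or_lt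
  · have hzero : ‖hχ.toL2‖ ^ 2 ≤ 0 := by
      rw [norm_sq_eq_integral_fourier]
      refine integral_nonpos_of_ae (hFM.mono fun ξ hξ ↦ ?_)
      rwa [← hm0, zero_mul] at hξ
    exact hzero.trans (mul_nonneg (poincareConst_nonneg hm0.le) henergy)
  · obtain ⟨R, hR0, hRm, hRP⟩ := exists_ball_volume_mul_eq_half hd s hm0
    have hsplit := integral_norm_sq_le_of_norm_sq_le hs0 hR0 hFM
      ((Lp.memLp (𝓕 (complexify hχ.toL2))).integrable_norm_pow two_ne_zero)
      (hχ.integrable_fracEnergy_toL2 hs0 hs1)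
    rw [← norm_sq_eq_integral_fourier, ← mul_assoc, hRm, ← fracEnergy] at hsplit
    rw [← hRP]
    linarith

end IsTestFunction

end Poincare

section Solutions

variable {s : ℝ} {Ω U : Set (EuclideanSpace ℝ (Fin d))} {f φ : EuclideanSpace ℝ (Fin d) → ℝ}
  {u : Lp ℝ 2 (volume : Measure (EuclideanSpace ℝ (Fin d)))}

lemma IsSolution.memHTilde_sub (hu : IsSolution s Ω f φ u) (hφ : IsTestFunction U φ) :
    MemHTilde s Ω (u - hφ.toL2) := by
  obtain ⟨φ', hφ', hw⟩ := hu.exterior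
  exact hφ.eq_toL2 hφ' ▸ hw

lemma IsTestFunction.setIntegral_mul_sub_toL2_nonneg (hφ : IsTestFunction Ωᶜ φ)
    (hΩ : MeasurableSet Ω) (hf0 : ∀ᵐ x ∂(volume.restrict Ω), 0 ≤ f x) (u : L²) :
    0 ≤ ∫ x in Ω, f x * u x * (u - hφ.toL2 : L²) x := by
  refine integral_nonneg_of_ae ?_
  filter_upwards [hf0, ae_restrict_mem hΩ, ae_restrict_of_ae hφ.coeFn_toL2,
    ae_restrict_of_ae (Lp.coeFn_sub u hφ.toL2)] with x hfx hx hφx hsub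
  rw [hsub, Pi.sub_apply, hφx, hφ.eq_zero_of_notMem (notMem_compl_iff.2 hx), sub_zero, mul_assoc]
  exact mul_nonneg hfx (mul_self_nonneg _)

lemma IsSolution.norm_toL2_sq_le (hu : IsSolution s Ω f φ u) (hd : 1 ≤ d) (hs0 : 0 ≤ s)
    (hs1 : s ≤ 1) (hΩ : MeasurableSet Ω) (hΩfin : volume Ω ≠ ⊤) (hφ : IsTestFunction U φ)
    {χ : 𝔼 → ℝ} (hχ : IsTestFunction Ω χ) (hz : sobolevNormSq s (u - hφ.toL2 - hχ.toL2) ≠ ⊤) :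
    ‖hχ.toL2‖ ^ 2 ≤ poincareConst d s (volume Ω).toReal *
      (2 * (eLpNorm (fourierFracLaplacian s φ) 2).toReal * ‖hχ.toL2‖ +
        (2 * π) ^ (2 * s) * (sobolevNormSq s (u - hφ.toL2 - hχ.toL2)).toReal -
        2 * ∫ x in Ω, f x * u x * hχ.toL2 x) := by
  refine (hχ.norm_toL2_sq_le_poincareConst_mul hd hs0 hs1 hΩ hΩfin).trans
    (mul_le_mul_of_nonneg_left ?_ (poincareConst_nonneg ENNReal.toReal_nonneg))
  have hχ_ae : ∫ x in Ω, f x * u x * hχ.toL2 x = ∫ x in Ω, f x * u x * χ x :=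
    integral_congr_ae ((ae_restrict_of_ae hχ.coeFn_toL2).mono fun x hx ↦ by simp only [hx])
  have henergy := hφ.fracEnergy_toL2_le hχ hs0 hs1 hz (hu.equation χ hχ)
  rw [hχ_ae]
  linarith [fracEnergy_le hs0 hz]

lemma IsSolution.norm_sub_toL2_le (hu : IsSolution s Ω f φ u) (hd : 1 ≤ d) (hs0 : 0 ≤ s)
    (hs1 : s ≤ 1) (hΩ : MeasurableSet Ω) (hΩfin : volume Ω ≠ ⊤) (hφ : IsTestFunction Ωᶜ φ)
    (hf : MemLp f ∞ (volume.restrict Ω)) (hf0 : ∀ᵐ x ∂(volume.restrict Ω), 0 ≤ f x) :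
    ‖u - hφ.toL2‖ ≤ 2 * poincareConst d s (volume Ω).toReal *
      (eLpNorm (fourierFracLaplacian s φ) 2).toReal := by
  set w := u - hφ.toL2
  set P := poincareConst d s (volume Ω).toReal
  set K := (eLpNorm (fourierFracLaplacian s φ) 2).toReal
  have hP0 : 0 ≤ P := poincareConst_nonneg ENNReal.toReal_nonneg
  have : 0 ≤ K := ENNReal.toReal_nonneg
  obtain ⟨χ, hχ, hlim⟩ := (hu.memHTilde_sub hφ).exists_seq
  have hχ_lim : Tendsto (fun n ↦ (hχ n).toL2) atTop (𝓝 w) :=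
    tendsto_of_tendsto_sobolevNormSq hs0 hlim
  have hrem_lim : Tendsto (fun n ↦ (sobolevNormSq s (w - (hχ n).toL2)).toReal) atTop (𝓝 0) :=
    (ENNReal.tendsto_toReal ENNReal.zero_ne_top).comp hlim
  have hpot_lim := ((continuous_setIntegral_mul_coeFn_Lp
    (((Lp.memLp u).restrict Ω).mul' hf)).tendsto w).comp hχ_lim
  have happrox : ∀ᶠ n in atTop, ‖(hχ n).toL2‖ ^ 2 ≤ P * (2 * K * ‖(hχ n).toL2‖ +
      (2 * π) ^ (2 * s) * (sobolevNormSq s (w - (hχ n).toL2)).toReal -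
      2 * ∫ x in Ω, f x * u x * (hχ n).toL2 x) := by
    filter_upwards [hlim.eventually_lt_const ENNReal.zero_lt_top] with n hn
    exact hu.norm_toL2_sq_le hd hs0 hs1 hΩ hΩfin hφ (hχ n) hn.ne
  have hlimit : ‖w‖ ^ 2 ≤ P * (2 * K * ‖w‖ + (2 * π) ^ (2 * s) * 0 -
      2 * ∫ x in Ω, f x * u x * w x) :=
    le_of_tendsto_of_tendsto (hχ_lim.norm.pow 2) ((((hχ_lim.norm.const_mul (2 * K)).add
      (hrem_lim.const_mul _)).sub (hpot_lim.const_mul 2)).const_mul P) happrox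
  have hpot := mul_nonneg hP0 (hφ.setIntegral_mul_sub_toL2_nonneg hΩ hf0 u)
  have hsq : ‖w‖ * ‖w‖ ≤ 2 * P * K * ‖w‖ := by linarith
  rcases (norm_nonneg w).eq_or_lt with h0 | h0
  · rw [← h0]
    positivity
  · exact le_of_mul_le_mul_right hsq h0

end Solutions

section ExteriorBound

variable {s δ : ℝ} {Ω D U : Set (EuclideanSpace ℝ (Fin d))}
  {f φ : EuclideanSpace ℝ (Fin d) → ℝ}
  {u : Lp ℝ 2 (volume : Measure (EuclideanSpace ℝ (Fin d)))}

/-- The representative `(-Δ)^s φ - ∫_Ω w(y) K_s(x - y) dy` of `(-Δ)^s (φ + w)` at positive distance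
from `Ω`, for `w ∈ H̃^s(Ω)`. -/
def exteriorFun (s : ℝ) (Ω : Set (EuclideanSpace ℝ (Fin d))) (φ w : 𝔼 → ℝ) (x : 𝔼) : ℝ :=
  fracLaplacianFun s φ x - jumpPotential s (Ω.indicator w) x

lemma IsTestFunction.fracLaplacian_toL2_add_eq_integral {ψ : 𝔼 → ℝ} {w : L²}
    (hφ : IsTestFunction U φ) (hψ : IsTestFunction D ψ) (hs0 : 0 < s) (hs1 : s < 1) (hδ : 0 < δ)
    (hΩ : MeasurableSet Ω) (hΩfin : volume Ω ≠ ⊤) (hsep : IsSeparatedBy δ Ω D)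
    (hw : MemHTilde s Ω w) :
    fracLaplacian s (hφ.toL2 + w) ψ = ((∫ x in D, exteriorFun s Ω φ w x * ψ x : ℝ) : ℂ) := by
  have hφ1 := memLp_one_iff_integrable.1 (hφ.memLp_fourierFracLaplacian hs0.le hs1.le 1)
  have hφψ : Integrable fun x ↦ fracLaplacianFun s φ x * ψ x :=
    hψ.integrable.bdd_mul (continuous_fracLaplacianFun hφ1).aestronglyMeasurable
      (ae_of_all _ fun x ↦ abs_fracLaplacianFun_le s φ x)
  have hwψ : Integrable fun x ↦ jumpPotential s (Ω.indicator w) x * ψ x :=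
    (hsep.mono support_indicator_subset hψ.support_subset).integrable_jumpPotential_mul hs0 hs1 hδ
      (integrable_indicator_coeFn_Lp hΩ hΩfin w) hψ.integrable
  rw [hψ.fracLaplacian_add hs0.le hs1.le,
    hφ.fracLaplacian_toL2_eq_integral hs0.le hs1.le hψ.integrable,
    hw.fracLaplacian_eq_neg_integral hs0 hs1 hδ hΩ hΩfin hsep hψ, hψ.setIntegral_mul,
    ← Complex.ofReal_add, ← sub_eq_add_neg, ← integral_sub hφψ hwψ]
  simp only [exteriorFun, sub_mul]

lemma IsSeparatedBy.abs_exteriorFun_le (hs0 : 0 < s) (hs1 : s < 1) (hδ : 0 < δ)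
    (hΩ : MeasurableSet Ω) (hΩfin : volume Ω ≠ ⊤) (hsep : IsSeparatedBy δ Ω D) (φ : 𝔼 → ℝ)
    (w : L²) {x : 𝔼} (hx : x ∈ D) :
    |exteriorFun s Ω φ w x| ≤ (∫ ξ, ‖fourierFracLaplacian s φ ξ‖) +
      jumpKernel d s δ * (√(volume Ω).toReal * ‖w‖) := by
  refine (abs_sub _ _).trans (add_le_add (abs_fracLaplacianFun_le s φ x) ?_)
  refine ((hsep.mono support_indicator_subset subset_rfl).abs_jumpPotential_le hs0 hs1 hδ
    (integrable_indicator_coeFn_Lp hΩ hΩfin w) hx).trans ?_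
  rw [finrank_euclideanSpace_fin]
  exact mul_le_mul_of_nonneg_left (integral_norm_indicator_coeFn_Lp_le hΩ hΩfin w)
    (jumpKernel_nonneg d hs0 hs1 hδ.le)

lemma IsTestFunction.aestronglyMeasurable_exteriorFun (hφ : IsTestFunction U φ) (hs0 : 0 ≤ s)
    (hs1 : s ≤ 1) (hΩ : MeasurableSet Ω) (w : L²) :
    AEStronglyMeasurable (exteriorFun s Ω φ w) :=
  (continuous_fracLaplacianFun (memLp_one_iff_integrable.1
    (hφ.memLp_fourierFracLaplacian hs0 hs1 1))).aestronglyMeasurable.sub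
      (aestronglyMeasurable_jumpPotential s ((Lp.aestronglyMeasurable w).indicator hΩ))

/-- The bound for `(-Δ)^s u` at distance `δ` from a set of measure `m`, for the solutions `u` with
exterior value `φ`. -/
def exteriorBound (s : ℝ) (φ : 𝔼 → ℝ) (m δ : ℝ) : ℝ :=
  (∫ ξ, ‖fourierFracLaplacian s φ ξ‖) + jumpKernel d s δ * (√m *
    (2 * poincareConst d s m * (eLpNorm (fourierFracLaplacian s φ) 2).toReal))

lemma IsSolution.abs_exteriorFun_le (hu : IsSolution s Ω f φ u) (hd : 1 ≤ d) (hs0 : 0 < s)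
    (hs1 : s < 1) (hδ : 0 < δ) (hΩ : MeasurableSet Ω) (hΩfin : volume Ω ≠ ⊤)
    (hsep : IsSeparatedBy δ Ω D) (hφ : IsTestFunction Ωᶜ φ) (hf : MemLp f ∞ (volume.restrict Ω))
    (hf0 : ∀ᵐ x ∂(volume.restrict Ω), 0 ≤ f x) {x : 𝔼} (hx : x ∈ D) :
    |exteriorFun s Ω φ (u - hφ.toL2 : L²) x| ≤ exteriorBound s φ (volume Ω).toReal δ := by
  refine (hsep.abs_exteriorFun_le hs0 hs1 hδ hΩ hΩfin φ _ hx).trans ?_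
  have hκ := jumpKernel_nonneg d hs0 hs1 hδ.le
  unfold exteriorBound
  gcongr
  exact hu.norm_sub_toL2_le hd hs0.le hs1.le hΩ hΩfin hφ hf hf0

end ExteriorBound

section SetDist

lemma isSeparatedBy_setDist (A B : Set 𝔼) : IsSeparatedBy (setDist A B) A B := by
  intro y hy x hx
  refine csInf_le ⟨0, ?_⟩ (mem_image2_of_mem hy hx)
  rintro _ ⟨a, -, b, -, rfl⟩
  exact dist_nonneg

lemma setDist_pos {A B : Set 𝔼} (hA : A.Nonempty) (hB : B.Nonempty) (hA_bdd : Bornology.IsBounded A)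
    (hAB : Disjoint (closure A) (closure B)) : 0 < setDist A B := by
  obtain ⟨r, hr0, hr⟩ :=
    Metric.exists_pos_forall_lt_edist hA_bdd.isCompact_closure isClosed_closure hAB
  refine (NNReal.coe_pos.2 hr0).trans_le (le_csInf (hA.image2 hB) ?_)
  rintro _ ⟨a, ha, b, hb, rfl⟩
  have hrab := (hr a (subset_closure ha) b (subset_closure hb)).le
  rw [edist_nndist, ENNReal.coe_le_coe] at hrab
  exact_mod_cast hrab

end SetDist

end FracSchrodinger

end

open FracSchrodinger

theorem mainTheorem7_general {d : ℕ} (hd : 1 ≤ d) {s : ℝ} (hs0 : 0 < s) (hs1 : s < 1) {δ : ℝ}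
    (hδ : 0 < δ) {Ω D : Set (EuclideanSpace ℝ (Fin d))} (hΩ : MeasurableSet Ω)
    (hΩfin : volume Ω ≠ ⊤) (hD : MeasurableSet D) (hsep : IsSeparatedBy δ Ω D)
    {φ : EuclideanSpace ℝ (Fin d) → ℝ} (hφ : IsTestFunction Ωᶜ φ)
    {f : EuclideanSpace ℝ (Fin d) → ℝ} (hf : MemLp f ∞ (volume.restrict Ω))
    (hf0 : ∀ᵐ x ∂(volume.restrict Ω), 0 ≤ f x)
    {u : Lp ℝ 2 (volume : Measure (EuclideanSpace ℝ (Fin d)))} (hu : IsSolution s Ω f φ u) :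
    ∃ g : EuclideanSpace ℝ (Fin d) → ℝ, FracLaplacianEqOn s u D g ∧
      eLpNorm g ∞ (volume.restrict D) ≤
        ENNReal.ofReal (exteriorBound s φ (volume Ω).toReal δ) := by
  set w := u - hφ.toL2
  have hbound : ∀ᵐ x ∂(volume.restrict D),
      ‖exteriorFun s Ω φ w x‖ ≤ exteriorBound s φ (volume Ω).toReal δ :=
    ae_restrict_of_forall_mem hD fun x hx ↦
      hu.abs_exteriorFun_le hd hs0 hs1 hδ hΩ hΩfin hsep hφ hf hf0 hx
  have hmem : MemLp (exteriorFun s Ω φ w) ∞ (volume.restrict D) :=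
    memLp_top_of_bound (hφ.aestronglyMeasurable_exteriorFun hs0.le hs1.le hΩ w).restrict _ hbound
  refine ⟨exteriorFun s Ω φ w, ⟨hmem, fun ψ hψ ↦ ?_⟩, eLpNormEssSup_le_of_ae_bound hbound⟩
  rw [← hφ.fracLaplacian_toL2_add_eq_integral hψ hs0 hs1 hδ hΩ hΩfin hsep (hu.memHTilde_sub hφ),
    add_sub_cancel]

theorem mainTheorem7 (d : ℕ) (hd : 1 ≤ d) (s : ℝ) (hs0 : 0 < s) (hs1 : s < 1)
    (φ : EuclideanSpace ℝ (Fin d) → ℝ) (m δ : ℝ) :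
    ∃ C : ℝ, 0 < C ∧
      ∀ Ω D : Set (EuclideanSpace ℝ (Fin d)),
        FracSchrodinger.IsBoundedSmoothDomain Ω →
        FracSchrodinger.IsBoundedSmoothDomain D →
        closure D ∩ closure Ω = ∅ →
        (volume Ω).toReal = m →
        FracSchrodinger.setDist Ω D = δ →
        FracSchrodinger.IsTestFunction (closure Ω)ᶜ φ →
        ∀ f : EuclideanSpace ℝ (Fin d) → ℝ,
          MemLp f ∞ (volume.restrict Ω) →
          (∀ᵐ x ∂(volume.restrict Ω), 0 ≤ f x) →
          ∀ u : Lp ℝ 2 (volume : Measure (EuclideanSpace ℝ (Fin d))),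
            FracSchrodinger.IsSolution s Ω f φ u →
            ∃ g : EuclideanSpace ℝ (Fin d) → ℝ,
              FracSchrodinger.FracLaplacianEqOn s u D g ∧
              eLpNorm g ∞ (volume.restrict D) ≤ ENNReal.ofReal C := by
  refine ⟨|exteriorBound s φ m δ| + 1, by positivity, ?_⟩
  rintro Ω D hΩ hD hdisj rfl rfl hφ f hf hf0 u hu
  have hφΩ : IsTestFunction Ωᶜ φ :=
    ⟨hφ.1, hφ.2.1, hφ.2.2.trans (Set.compl_subset_compl.2 subset_closure)⟩
  obtain ⟨g, hg, hg_le⟩ := mainTheorem7_general hd hs0 hs1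
    (setDist_pos hΩ.isConnected.nonempty hD.isConnected.nonempty hΩ.isBounded
      (Set.disjoint_iff_inter_eq_empty.2 (Set.inter_comm _ _ ▸ hdisj)))
    hΩ.isOpen.measurableSet hΩ.isBounded.measure_lt_top.ne hD.isOpen.measurableSet
    (isSeparatedBy_setDist Ω D) hφΩ hf hf0 hu
  exact ⟨g, hg, hg_le.trans (ENNReal.ofReal_le_ofReal
    ((le_abs_self _).trans (le_add_of_nonneg_right zero_le_one)))⟩
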